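/- Let $\Omega\subset\mathbb{R}^N$ be a bounded open set (for instance, a smooth bounded domain). Let $H^1_0(\Omega)$ be the closure of $C_c^\infty(\Omega)$ in $W^{1,2}(\Omega)$, with norm $\|u\|_{1,2}=(\|u\|_{L^2}^2+\|\nabla u\|_{L^2}^2)^{1/2}$, and let $H^{-1}(\Omega)$ be its dual with the dual norm. Let $j:\Omega\times\mathbb{R}\times\mathbb{R}^N\to\mathbb{R}$ be such that $j(\cdot,s,\xi)$ is measurable for all $(s,\xi)$, $j(x,\cdot,\cdot)$ is of class $C^1$ for a.e. $x\in\Omega$, and $\xi\mapsto j(x,s,\xi)$ is strictly convex for a.e. $x\in\Omega$ and all $s\in\mathbb{R}$. Suppose that there are continuous functions $\alpha,\gamma,\mu:[0,\infty)\to[0,\infty)$ with $\alpha\ge 1$ such that, for a.e. $x\in\Omega$ and all $(s,\xi)\in\mathbb{R}\times\mathbb{R}^N$, $$\frac{1}{\alpha(|s|)}|\xi|^2\le j(x,s,\xi)\le\alpha(|s|)|\xi|^2,\qquad |j_s(x,s,\xi)|\le\gamma(|s|)|\xi|^2,\qquad |j_\xi(x,s,\xi)|\le\mu(|s|)|\xi|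 .$$ Suppose also that there are $\varepsilon\in(0,1)$ and $R\ge 0$ such that $$(1-\varepsilon)\,j_\xi(x,s,\xi)\cdot\xi+j_s(x,s,\xi)\,s\ge 0$$ for a.e. $x\in\Omega$ and all $(s,\xi)\in\mathbb{R}\times\mathbb{R}^N$ with $|s|\ge R$. Define $I:H^1_0(\Omega)\to[0,+\infty]$ by $I(u)=\int_\Omega j(x,u,\nabla u)\,dx$. Weak slope. For a continuous function $g:X\to\mathbb{R}$ on a metric space, $|dg|(u)$ is the supremum of the $\sigma\ge 0$ for which there are $\delta>0$ and a continuous map $\mathcal{H}:B(u,\delta)\times[0,\delta]\to X$ with $d(\mathcal{H}(v,t),v)\le t$ and $g(\mathcal{H}(v,t))\le g(v)-\sigma t$ for all $v\in B(u,\delta)$ and $t\in[0,\delta]$. For a lower semicontinuous $f:X\to\mathbb{R}\cup\{+\infty\}$ and $u$ with $f(u)<+\infty$, let $\mathcal{G}_f(v,\eta)=\eta$ on $\{(v,\eta)\in X\times\mathbb{R}: f(v)\le\eta\}$, endowed with the metric $(d(v,v')^2+(\eta-\eta')^2)^{1/2}$, and let $a=|d\mathcal{G}_f|(u,f(u))\in[0,1]$;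 then $|df|(u)=a/\sqrt{1-a^2}$ if $a<1$, and $|df|(u)=+\infty$ if $a=1$. Then, for every $u\in H^1_0(\Omega)$ with $I(u)<+\infty$ and $|dI|(u)<+\infty$, one has $$j_\xi(x,u,\nabla u)\cdot\nabla u\in L^1(\Omega),\qquad j_s(x,u,\nabla u)\,u\in L^1(\Omega),$$ $$\int_\Omega \big(j_\xi(x,u,\nabla u)\cdot\nabla u+j_s(x,u,\nabla u)\,u\big)\,dx\le |dI|(u)\,\|u\|_{1,2},$$ and there is $\Psi\in H^{-1}(\Omega)$ with $\|\Psi\|_{H^{-1}}\le|dI|(u)$ such that, for every $w$ in $$V_u=\{w\in H^1_0(\Omega)\cap L^\infty(\Omega): u\in L^\infty(\{w\ne 0\})\},$$ the functions $j_\xi(x,u,\nabla u)\cdot\nabla w$ and $j_s(x,u,\nabla u)\,w$ are in $L^1(\Omega)$ and $$\int_\Omega j_\xi(x,u,\nabla u)\cdot\nabla w\,dx+\int_\Omega j_s(x,u,\nabla u)\,w\,dx=\langle\Psi,w\rangle .$$ -/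

import Mathlib

open MeasureTheory Set
open scoped ENNReal NNReal ContDiff Gradient

noncomputable section

/-! ### The weak slope -/

/-- The weak slope of a (continuous) function `g : X → ℝ` at `u`: the supremum of the `σ ≥ 0` for
which there are `δ > 0` and a continuous `H : B(u, δ) × [0, δ] → X` with
`d(H(v, t), v) ≤ t` and `g(H(v, t)) ≤ g(v) - σ t`. -/
def weakSlopeCont {X : Type*} [PseudoMetricSpace X] (g : X → ℝ) (u : X) : ℝ≥0∞ :=
  ⨆ σ : ℝ≥0, ⨆ _ : ∃ δ : ℝ, 0 < δ ∧ ∃ H : X × ℝ → X,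
      ContinuousOn H (Metric.ball u δ ×ˢ Icc 0 δ) ∧
      ∀ v ∈ Metric.ball u δ, ∀ t ∈ Icc 0 δ,
        dist (H (v, t)) v ≤ t ∧ g (H (v, t)) ≤ g v - σ * t,
    (σ : ℝ≥0∞)

/-- The epigraph of `f : X → ℝ ∪ {+∞}`, with the metric
`((d(u, v))² + (η - ζ)²)^{1/2}` inherited from the `ℓ²` product `X × ℝ`. -/
abbrev Epigraph {X : Type*} (f : X → EReal) : Type _ :=
  {p : WithLp 2 (X × ℝ) // f p.fst ≤ (p.snd : EReal)}

/-- The height function `(u, η) ↦ η` on the epigraph. -/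
def epiHeight {X : Type*} (f : X → EReal) : Epigraph f → ℝ := fun p => p.1.snd

/-- The point `(u, f(u))` of the epigraph, for `u` in the domain of `f`. -/
def epiPoint {X : Type*} (f : X → EReal) (u : X) (hu : f u ≠ ⊤) : Epigraph f :=
  ⟨WithLp.toLp 2 (u, (f u).toReal), EReal.le_coe_toReal hu⟩

/-- The weak slope `|df|(u) ∈ [0, +∞]` of a lower semicontinuous `f : X → ℝ ∪ {+∞}` at a point `u`
of its domain: with `a = |d𝒢_f|(u, f(u))` the weak slope of the (1-Lipschitz) height function
of the epigraph, it is `a / √(1 - a²)` if `a < 1` and `+∞` if `a = 1`. -/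
def weakSlope {X : Type*} [PseudoMetricSpace X] (f : X → EReal) (u : X) (hu : f u ≠ ⊤) : ℝ≥0∞ :=
  let a : ℝ≥0∞ := weakSlopeCont (epiHeight f) (epiPoint f u hu)
  if a < 1 then ENNReal.ofReal (a.toReal / √(1 - a.toReal ^ 2)) else ⊤

/-! ### The Sobolev space `H¹₀(Ω)` -/

/-- Pairs `(u, U)` with `u ∈ L²(Ω)`, `U ∈ L²(Ω; ℝᴺ)` and the Hilbert norm
`(‖u‖₂² + ‖U‖₂²)^{1/2}`. -/
abbrev L2Pair {N : ℕ} (Ω : Set (EuclideanSpace ℝ (Fin N))) : Type :=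
  WithLp 2 (Lp ℝ 2 (volume.restrict Ω) × Lp (EuclideanSpace ℝ (Fin N)) 2 (volume.restrict Ω))

/-- The pairs `(φ, ∇φ)` with `φ ∈ C_c^∞(Ω)`. -/
def testPairs {N : ℕ} (Ω : Set (EuclideanSpace ℝ (Fin N))) : Submodule ℝ (L2Pair Ω) where
  carrier := {p | ∃ φ : EuclideanSpace ℝ (Fin N) → ℝ,
    ContDiff ℝ ∞ φ ∧ HasCompactSupport φ ∧ tsupport φ ⊆ Ω ∧
    p.fst =ᵐ[volume.restrict Ω] φ ∧ p.snd =ᵐ[volume.restrict Ω] ∇ φ}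
  zero_mem' := by
    refine ⟨0, contDiff_const, HasCompactSupport.zero, by simp [tsupport], ?_, ?_⟩
    · exact Lp.coeFn_zero _ _ _
    · refine (Lp.coeFn_zero _ _ _).trans (.of_forall fun x => ?_)
      simp [gradient]
  add_mem' := by
    rintro p q ⟨φ, h1, h2, h3, h4, h5⟩ ⟨ψ, k1, k2, k3, k4, k5⟩
    refine ⟨φ + ψ, h1.add k1, h2.add k2, (tsupport_add φ ψ).trans (union_subset h3 k3), ?_, ?_⟩
    · exact (Lp.coeFn_add p.fst q.fst).trans (h4.add k4)
    · refine (Lp.coeFn_add p.snd q.snd).trans ((h5.add k5).trans (.of_forall fun x => ?_))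
      simp only [Pi.add_apply, gradient]
      rw [fderiv_add (h1.differentiable (by simp) x) (k1.differentiable (by simp) x), map_add]
  smul_mem' := by
    rintro c p ⟨φ, h1, h2, h3, h4, h5⟩
    refine ⟨c • φ, contDiff_const.smul h1, h2.smul_left (f := fun _ => c),
      (tsupport_smul_subset_right (fun _ => c) φ).trans h3, ?_, ?_⟩
    · exact (Lp.coeFn_smul c p.fst).trans (h4.const_smul c)
    · refine (Lp.coeFn_smul c p.snd).trans ((h5.const_smul c).trans (.of_forall fun x => ?_))
      simp only [Pi.smul_apply, gradient]
      rw [fderiv_const_smul (h1.differentiable (by simp) x), map_smul]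

/-- `H¹₀(Ω)`, the closure of `C_c^∞(Ω)` in the `W^{1,2}` norm; an element is the pair consisting of
the function and its weak gradient, and the norm is `(‖u‖₂² + ‖∇u‖₂²)^{1/2}`. -/
def H10 {N : ℕ} (Ω : Set (EuclideanSpace ℝ (Fin N))) : Submodule ℝ (L2Pair Ω) :=
  (testPairs Ω).topologicalClosure

/-- The function underlying an element of `H¹₀(Ω)`. -/
def h10Val {N : ℕ} {Ω : Set (EuclideanSpace ℝ (Fin N))} (u : H10 Ω) :
    EuclideanSpace ℝ (Fin N) → ℝ :=
  u.1.fst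

/-- The weak gradient of an element of `H¹₀(Ω)`. -/
def h10Grad {N : ℕ} {Ω : Set (EuclideanSpace ℝ (Fin N))} (u : H10 Ω) :
    EuclideanSpace ℝ (Fin N) → EuclideanSpace ℝ (Fin N) :=
  u.1.snd

/-- `V_u = {w ∈ H¹₀(Ω) ∩ L^∞(Ω) : u ∈ L^∞({w ≠ 0})}`. -/
def VSpace {N : ℕ} (Ω : Set (EuclideanSpace ℝ (Fin N))) (u : EuclideanSpace ℝ (Fin N) → ℝ) :
    Set (H10 Ω) :=
  {w | MemLp (h10Val w) ∞ (volume.restrict Ω) ∧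
    MemLp u ∞ ((volume.restrict Ω).restrict {x | h10Val w x ≠ 0})}

/-! ### The integrand and the functional -/

/-- The partial derivative `j_s(x, s, ξ)`. -/
def jS {N : ℕ} (j : EuclideanSpace ℝ (Fin N) → ℝ → EuclideanSpace ℝ (Fin N) → ℝ)
    (x : EuclideanSpace ℝ (Fin N)) (s : ℝ) (ξ : EuclideanSpace ℝ (Fin N)) : ℝ :=
  deriv (fun t => j x t ξ) s

/-- The partial gradient `j_ξ(x, s, ξ)`. -/
def jXi {N : ℕ} (j : EuclideanSpace ℝ (Fin N) → ℝ → EuclideanSpace ℝ (Fin N) → ℝ)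
    (x : EuclideanSpace ℝ (Fin N)) (s : ℝ) (ξ : EuclideanSpace ℝ (Fin N)) :
    EuclideanSpace ℝ (Fin N) :=
  ∇ (fun η => j x s η) ξ

/-- `I(u) = ∫_Ω j(x, u, ∇u) ∈ [0, +∞]` on `H¹₀(Ω)`, for a nonnegative integrand `j`. -/
def energy {N : ℕ} (Ω : Set (EuclideanSpace ℝ (Fin N)))
    (j : EuclideanSpace ℝ (Fin N) → ℝ → EuclideanSpace ℝ (Fin N) → ℝ) (u : H10 Ω) : EReal :=
  ((∫⁻ x in Ω, ENNReal.ofReal (j x (h10Val u x) (h10Grad u x)) : ℝ≥0∞) : EReal)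

end

open Filter Topology

/-! If a continuous field `Z` on $H^1_0(\Omega)$ with $\|Z\|\le b$ near $u$ makes the energy fall at
rate $\sigma b$ along $v+tZ(v)$ for all $v$ near $u$, then $|dI|(u)\ge\sigma$
(`le_weakSlope_of_deformation`). Read backwards, a finite slope forbids steep descent along any such
field.

The energy is neither differentiable nor continuous, so a steep derivative at $u$ must be carried
over to nearby $v$ by Fatou's lemma. This works as soon as the difference quotients of $j$ along the
field are bounded above by $G=C(|\nabla v|^2+|\nabla Z(v)|^2)$, whose integral depends continuously
on $v$. The outcome is `integral_derivative_le_weakSlope`: the derivative of the integrand along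
$Z(u)$ is integrable, with integral at least $-|dI|(u)\|Z(u)\|$.

Two fields are fed into it. For $Z(v)=-v$ the sign condition stops $j$ from increasing where $|v|\ge
2R$, and the growth bounds apply elsewhere; this tests the equation with $u$. For $w\in V_u$ the
field $Z(v)=\Phi(v,w)$, with $\Phi$ a smooth cutoff, satisfies $Z(u)=w$ and vanishes where $|v|$ is
large, so the growth bounds suffice. Applied to $\pm w$, it bounds a linear functional on a subspace
by $|dI|(u)\|w\|$, and Hahn–Banach provides $\Psi$. -/

/-! ### Lower bounds for the weak slope from deformations. -/

/-- The maps $a\mapsto a/\sqrt{1-a^2}$ and $\sigma\mapsto\sigma/\sqrt{1+\sigma^2}$ are increasing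
and inverse to each other; this converts a slope of the height function into a slope of $f$. -/
theorem le_div_sqrt_one_sub_sq {σ a : ℝ} (hσ : 0 ≤ σ) (ha : a < 1) (h : σ / √(1 + σ ^ 2) ≤ a) :
    σ ≤ a / √(1 - a ^ 2) := by
  have h1 : 0 < √(1 + σ ^ 2) := by positivity
  have ha0 : 0 ≤ a := le_trans (by positivity) h
  have h2 : 0 < 1 - a ^ 2 := by nlinarith
  rw [div_le_iff₀ h1] at h
  rw [le_div_iff₀ (Real.sqrt_pos.2 h2)]
  refine le_of_sq_le_sq ?_ ha0
  have h3 : σ ^ 2 ≤ a ^ 2 * (1 + σ ^ 2) := by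
    have := pow_le_pow_left₀ hσ h 2
    rwa [mul_pow, Real.sq_sqrt (by positivity)] at this
  rw [mul_pow, Real.sq_sqrt h2.le]
  nlinarith

/-- A deformation along a continuous field `Z` which decreases `f` at rate `σ b`, where `b` bounds
`‖Z‖`, bounds the weak slope from below by `σ`. -/
theorem le_weakSlope_of_deformation {X : Type*} [NormedAddCommGroup X] [NormedSpace ℝ X]
    {f : X → EReal} {u : X} (hu : f u ≠ ⊤) {Z : X → X} (hZ : Continuous Z) {b σ δ : ℝ}
    (hb : 0 < b) (hσ : 0 ≤ σ) (hδ : 0 < δ)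
    (hbd : ∀ v ∈ Metric.ball u δ, ‖Z v‖ ≤ b)
    (hdec : ∀ v ∈ Metric.ball u δ, ∀ t ∈ Icc 0 δ,
      f (v + t • Z v) + ((σ * b * t : ℝ) : EReal) ≤ f v) :
    ENNReal.ofReal σ ≤ weakSlope f u hu := by
  classical
  set S : ℝ := √(1 + σ ^ 2) with hS
  have hSpos : 0 < S := by positivity
  have hS2 : S ^ 2 = 1 + σ ^ 2 := Real.sq_sqrt (by positivity)
  -- Time is rescaled by `l` so that the motion in the epigraph, at most $ltb$ horizontally and
  -- $\sigma b\,lt$ vertically, has length at most $t$. The height then falls at rate $\sigma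
  -- b\,l=\sigma/S$.
  set l : ℝ := 1 / (b * S) with hl
  have hlpos : 0 < l := by positivity
  set A : ℝ≥0∞ := weakSlopeCont (epiHeight f) (epiPoint f u hu) with hA
  have key : ENNReal.ofReal (σ / S) ≤ A := by
    rw [hA, weakSlopeCont, ENNReal.ofReal]
    refine le_iSup₂_of_le (Real.toNNReal (σ / S)) ?_ le_rfl
    set δ' : ℝ := min δ (δ / l) with hδ'
    have hδ'pos : 0 < δ' := by positivity
    let K : Epigraph f × ℝ → WithLp 2 (X × ℝ) := fun p =>
      WithLp.toLp 2 (p.1.1.fst + (l * p.2) • Z p.1.1.fst, p.1.1.snd - σ * b * (l * p.2))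
    have hK : Continuous K := by
      have h1 : Continuous fun p : Epigraph f × ℝ => p.1.1.fst :=
        (continuous_fst.comp (WithLp.prod_continuous_ofLp 2 X ℝ)).comp
          (continuous_subtype_val.comp continuous_fst)
      have h2 : Continuous fun p : Epigraph f × ℝ => p.1.1.snd :=
        (continuous_snd.comp (WithLp.prod_continuous_ofLp 2 X ℝ)).comp
          (continuous_subtype_val.comp continuous_fst)
      refine (WithLp.prod_continuous_toLp 2 X ℝ).comp ?_
      fun_prop
    -- The fallback `p.1` only makes `H` total: on the ball and times considered, `K` stays in the
    -- epigraph, so `H` inherits the continuity of `K`.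
    let H : Epigraph f × ℝ → Epigraph f := fun p =>
      if h : f (K p).fst ≤ ((K p).snd : EReal) then ⟨K p, h⟩ else p.1
    have hgood : ∀ v ∈ Metric.ball (epiPoint f u hu) δ', ∀ t ∈ Icc 0 δ', (H (v, t)).1 = K (v, t)
        ∧ v.1.fst ∈ Metric.ball u δ := by
      intro v hv t ht
      have hvu : v.1.fst ∈ Metric.ball u δ := by
        rw [Metric.mem_ball] at hv ⊢
        have h1 : dist v (epiPoint f u hu) = dist v.1 (epiPoint f u hu).1 := rfl
        rw [h1, WithLp.prod_dist_eq_of_L2] at hv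
        refine lt_of_le_of_lt ?_ (lt_of_lt_of_le hv (min_le_left _ _))
        refine Real.le_sqrt_of_sq_le ?_
        have : (epiPoint f u hu).1.fst = u := rfl
        rw [this]
        have := sq_nonneg (dist v.1.snd (epiPoint f u hu).1.snd)
        linarith
      refine ⟨?_, hvu⟩
      have hlt : l * t ∈ Icc 0 δ := by
        refine ⟨mul_nonneg hlpos.le ht.1, ?_⟩
        have := ht.2.trans (min_le_right _ _)
        rwa [le_div_iff₀' hlpos] at this
      -- The decrease holds at every point of the ball, whatever its energy, so a point at any level
      -- $\eta\ge f(v)$ can be lowered by the same amount.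
      have h2 := (hdec _ hvu _ hlt).trans v.2
      have h3 : f (K (v, t)).fst ≤ ((K (v, t)).snd : EReal) := by
        change f (v.1.fst + (l * t) • Z v.1.fst) ≤ ((v.1.snd - σ * b * (l * t) : ℝ) : EReal)
        rw [EReal.coe_sub]
        exact EReal.le_sub_iff_add_le (.inl (EReal.coe_ne_bot _)) (.inl (EReal.coe_ne_top _)) |>.2 h2
      simp only [H, dif_pos h3]
    refine ⟨δ', hδ'pos, H, ?_, ?_⟩
    · rw [continuousOn_iff_continuous_domRestrict]
      refine Topology.IsInducing.subtypeVal.continuous_iff.2 ?_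
      have : (Subtype.val ∘ (Metric.ball (epiPoint f u hu) δ' ×ˢ Icc 0 δ').domRestrict H)
          = (Metric.ball (epiPoint f u hu) δ' ×ˢ Icc 0 δ').domRestrict K := by
        funext p
        exact (hgood p.1.1 p.2.1 p.1.2 p.2.2).1
      exact this ▸ hK.comp continuous_subtype_val
    · intro v hv t ht
      obtain ⟨h1, h2⟩ := hgood v hv t ht
      have hZb := hbd _ h2
      constructor
      · have : dist (H (v, t)) v = dist (K (v, t)) v.1 := by rw [← h1]; rfl
        rw [this, WithLp.prod_dist_eq_of_L2]
        refine Real.sqrt_le_iff.2 ⟨ht.1, ?_⟩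
        have e1 : dist (K (v, t)).fst v.1.fst = l * t * ‖Z v.1.fst‖ := by
          change dist (v.1.fst + (l * t) • Z v.1.fst) v.1.fst = _
          rw [dist_self_add_left, norm_smul, Real.norm_of_nonneg (mul_nonneg hlpos.le ht.1)]
        have e2 : dist (K (v, t)).snd v.1.snd = σ * b * (l * t) := by
          change dist (v.1.snd - σ * b * (l * t)) v.1.snd = _
          rw [Real.dist_eq, sub_sub_cancel_left, abs_neg, abs_of_nonneg]
          have := ht.1
          positivity
        rw [e1, e2]
        have e3 : (l * t * ‖Z v.1.fst‖) ^ 2 ≤ (l * t * b) ^ 2 := by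
          have := ht.1
          gcongr
        have e4 : (l * t * b) ^ 2 + (σ * b * (l * t)) ^ 2 = t ^ 2 := by
          rw [hl]
          field_simp
          rw [hS2]
          ring
        linarith
      · have e : epiHeight f (H (v, t)) = v.1.snd - σ * b * (l * t) := by
          change (H (v, t)).1.snd = _
          rw [h1]
          rfl
        rw [e, Real.coe_toNNReal _ (by positivity)]
        refine le_of_eq ?_
        change v.1.snd - _ = v.1.snd - _
        rw [hl]
        field_simp
  rw [weakSlope]
  simp only [← hA]
  split_ifs with hlt
  · refine ENNReal.ofReal_le_ofReal (le_div_sqrt_one_sub_sq hσ ?_ ?_)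
    · rw [← ENNReal.toReal_one]
      exact (ENNReal.toReal_lt_toReal hlt.ne_top ENNReal.one_ne_top).2 hlt
    · rwa [← ENNReal.ofReal_le_iff_le_toReal hlt.ne_top]
  · exact le_top

/-! ### Pointwise calculus of the integrand. -/

/-- Composition of a Carathéodory function with a measurable map. -/
theorem aemeasurable_comp_caratheodory {X P : Type*} [MeasurableSpace X] {ν : Measure X}
    [TopologicalSpace P] [TopologicalSpace.PseudoMetrizableSpace P] [T1Space P]
    {F : X → P → ℝ} (hm : ∀ p, AEMeasurable (fun x => F x p) ν)
    (hc : ∀ᵐ x ∂ν, Continuous (F x)) {a : X → P} (ha : AEStronglyMeasurable a ν) :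
    AEMeasurable (fun x => F x (a x)) ν := by
  classical
  obtain ⟨a', ha', hae⟩ := ha
  have hsimple : ∀ f : SimpleFunc X P, AEMeasurable (fun x => F x (f x)) ν := by
    intro f
    -- Along a simple function the composition is a finite sum of slices cut off to the fibres; the
    -- general case is a pointwise limit, by continuity in the second variable.
    have : (fun x => F x (f x))
        = fun x => ∑ y ∈ f.range, (f ⁻¹' {y}).indicator (fun x => F x y) x := by
      funext x
      rw [Finset.sum_eq_single (f x)]
      · simp
      · intro y _ hy
        exact indicator_of_notMem (fun h => hy (by simpa using h.symm)) _
      · intro h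
        exact absurd (f.mem_range_self x) h
    rw [this]
    exact Finset.aemeasurable_fun_sum _ fun y _ => (hm y).indicator (f.measurableSet_fiber y)
  have h1 : AEMeasurable (fun x => F x (a' x)) ν := by
    refine aemeasurable_of_tendsto_metrizable_ae atTop (fun n => hsimple (ha'.approx n)) ?_
    filter_upwards [hc] with x hx
    exact (hx.tendsto _).comp (ha'.tendsto_approx x)
  refine h1.congr ?_
  filter_upwards [hae] with x hx
  rw [hx]

section Integrand

variable {N : ℕ} {j : EuclideanSpace ℝ (Fin N) → ℝ → EuclideanSpace ℝ (Fin N) → ℝ}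
  {x : EuclideanSpace ℝ (Fin N)}

/-- The joint derivative of `j(x, ·, ·)` in terms of its partial derivatives. -/
theorem fderiv_apply_eq_jS_add_jXi
    (h : ContDiff ℝ 1 (fun p : ℝ × EuclideanSpace ℝ (Fin N) => j x p.1 p.2))
    (s z : ℝ) (ξ ζ : EuclideanSpace ℝ (Fin N)) :
    fderiv ℝ (fun p : ℝ × EuclideanSpace ℝ (Fin N) => j x p.1 p.2) (s, ξ) (z, ζ)
      = jS j x s ξ * z + inner ℝ (jXi j x s ξ) ζ := by
  have hD := (h.differentiable (by simp) (s, ξ)).hasFDerivAt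
  set D := fderiv ℝ (fun p : ℝ × EuclideanSpace ℝ (Fin N) => j x p.1 p.2) (s, ξ)
  have h1 : HasDerivAt (fun t => j x t ξ) (D (1, 0)) s :=
    HasFDerivAt.comp_hasDerivAt (l := fun p : ℝ × EuclideanSpace ℝ (Fin N) => j x p.1 p.2) s hD
      ((hasDerivAt_id s).prodMk (hasDerivAt_const s ξ))
  have h2 : HasFDerivAt (fun η => j x s η) (D.comp (ContinuousLinearMap.inr ℝ ℝ _)) ξ :=
    hD.comp ξ (hasFDerivAt_prodMk_right s ξ)
  have e1 : jS j x s ξ = D (1, 0) := h1.deriv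
  have e2 : inner ℝ (jXi j x s ξ) ζ = D (0, ζ) := by
    rw [jXi, gradient, InnerProductSpace.toDual_symm_apply, h2.fderiv]
    simp
  have e3 : ((z, ζ) : ℝ × EuclideanSpace ℝ (Fin N)) = z • (1, 0) + (0, ζ) := by simp
  rw [e1, e2, e3, map_add, map_smul, smul_eq_mul, mul_comm]

theorem hasDerivAt_integrand_line
    (h : ContDiff ℝ 1 (fun p : ℝ × EuclideanSpace ℝ (Fin N) => j x p.1 p.2))
    (s z : ℝ) (ξ ζ : EuclideanSpace ℝ (Fin N)) (t : ℝ) :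
    HasDerivAt (fun t : ℝ => j x (s + t * z) (ξ + t • ζ))
      (jS j x (s + t * z) (ξ + t • ζ) * z + inner ℝ (jXi j x (s + t * z) (ξ + t • ζ)) ζ) t := by
  rw [← fderiv_apply_eq_jS_add_jXi h]
  have hD := (h.differentiable (by simp) (s + t * z, ξ + t • ζ)).hasFDerivAt
  have h1 : HasDerivAt (fun t : ℝ => s + t * z) z t := by
    simpa using ((hasDerivAt_id t).mul_const z).const_add s
  have h2 : HasDerivAt (fun t : ℝ => ξ + t • ζ) ζ t := by
    simpa using ((hasDerivAt_id t).smul_const ζ).const_add ξ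
  exact hD.comp_hasDerivAt t (h1.prodMk h2)

/-- Convergence of difference quotients of `j(x, ·, ·)` along converging base points and
directions. -/
theorem tendsto_integrand_quotient
    (h : ContDiff ℝ 1 (fun p : ℝ × EuclideanSpace ℝ (Fin N) => j x p.1 p.2))
    {ι : Type*} {l : Filter ι} {s z t : ι → ℝ} {ξ ζ : ι → EuclideanSpace ℝ (Fin N)}
    {s₀ z₀ : ℝ} {ξ₀ ζ₀ : EuclideanSpace ℝ (Fin N)}
    (hs : Tendsto s l (𝓝 s₀)) (hz : Tendsto z l (𝓝 z₀)) (hξ : Tendsto ξ l (𝓝 ξ₀))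
    (hζ : Tendsto ζ l (𝓝 ζ₀)) (ht : Tendsto t l (𝓝[>] 0)) :
    Tendsto (fun n => (j x (s n + t n * z n) (ξ n + t n • ζ n) - j x (s n) (ξ n)) / t n) l
      (𝓝 (jS j x s₀ ξ₀ * z₀ + inner ℝ (jXi j x s₀ ξ₀) ζ₀)) := by
  rw [← fderiv_apply_eq_jS_add_jXi h]
  -- Strict differentiability, available for $C^1$ functions, lets the base point move together with
  -- the increment.
  have hD := (h.contDiffAt (x := (s₀, ξ₀))).hasStrictFDerivAt (by simp)
  set D := fderiv ℝ (fun p : ℝ × EuclideanSpace ℝ (Fin N) => j x p.1 p.2) (s₀, ξ₀)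
  obtain ⟨ht0, htpos⟩ := tendsto_nhdsWithin_iff.1 ht
  have hlim : Tendsto (fun n => ((s n + t n * z n, ξ n + t n • ζ n), (s n, ξ n))) l
      (𝓝 (((s₀, ξ₀), (s₀, ξ₀)) :
        (ℝ × EuclideanSpace ℝ (Fin N)) × (ℝ × EuclideanSpace ℝ (Fin N)))) := by
    have h1 : Tendsto (fun n => s n + t n * z n) l (𝓝 s₀) := by
      simpa using hs.add (ht0.mul hz)
    have h2 : Tendsto (fun n => ξ n + t n • ζ n) l (𝓝 ξ₀) := by
      simpa using hξ.add (ht0.smul hζ)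
    exact (h1.prodMk_nhds h2).prodMk_nhds (hs.prodMk_nhds hξ)
  have ho := hD.isLittleO.comp_tendsto hlim
  have hzζ : Tendsto (fun n => (z n, ζ n)) l (𝓝 (z₀, ζ₀)) := hz.prodMk_nhds hζ
  have hdir : ∀ n, ((s n + t n * z n, ξ n + t n • ζ n) : ℝ × EuclideanSpace ℝ (Fin N))
      - (s n, ξ n) = t n • (z n, ζ n) := by
    intro n
    ext <;> simp
  have ho2 : (fun n => j x (s n + t n * z n) (ξ n + t n • ζ n) - j x (s n) (ξ n)
      - t n * D (z n, ζ n)) =o[l] t := by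
    refine (ho.congr_left ?_).trans_isBigO ?_
    · intro n
      simp only [Function.comp]
      rw [hdir, map_smul, smul_eq_mul]
    · have : ((fun p : (ℝ × EuclideanSpace ℝ (Fin N)) × (ℝ × EuclideanSpace ℝ (Fin N)) =>
          p.1 - p.2) ∘ fun n => ((s n + t n * z n, ξ n + t n • ζ n), (s n, ξ n)))
          = fun n => t n • (z n, ζ n) := funext hdir
      rw [this]
      simpa using (Asymptotics.isBigO_refl t l).smul (hzζ.isBigO_one ℝ)
  have h3 := ho2.tendsto_div_nhds_zero.add ((D.continuous.tendsto _).comp hzζ)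
  rw [zero_add] at h3
  refine h3.congr' ?_
  filter_upwards [htpos] with n hn
  have : t n ≠ 0 := ne_of_gt hn
  simp only [Function.comp]
  field_simp
  ring

/-- A quadratic bound for increments of `j(x, ·, ·)`, for bounded `s` and `z`. -/
theorem abs_integrand_sub_le
    (h : ContDiff ℝ 1 (fun p : ℝ × EuclideanSpace ℝ (Fin N) => j x p.1 p.2))
    {Γ M K L : ℝ} (hΓ : 0 ≤ Γ) (hM : 0 ≤ M)
    (hbd : ∀ s ξ, |s| ≤ K + L → |jS j x s ξ| ≤ Γ * ‖ξ‖ ^ 2 ∧ ‖jXi j x s ξ‖ ≤ M * ‖ξ‖)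
    {s z t : ℝ} (hs : |s| ≤ K) (hz : |z| ≤ L) (ht : t ∈ Icc (0 : ℝ) 1)
    (ξ ζ : EuclideanSpace ℝ (Fin N)) :
    |j x (s + t * z) (ξ + t • ζ) - j x s ξ|
      ≤ t * ((2 * Γ * L + 2 * M) * (‖ξ‖ ^ 2 + ‖ζ‖ ^ 2)) := by
  have hL : 0 ≤ L := (abs_nonneg z).trans hz
  have hderiv : ∀ τ ∈ Icc (0 : ℝ) 1,
      ‖jS j x (s + τ * z) (ξ + τ • ζ) * z + inner ℝ (jXi j x (s + τ * z) (ξ + τ • ζ)) ζ‖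
        ≤ (2 * Γ * L + 2 * M) * (‖ξ‖ ^ 2 + ‖ζ‖ ^ 2) := by
    intro τ hτ
    have hsz : |s + τ * z| ≤ K + L := by
      refine (abs_add_le _ _).trans (add_le_add hs ?_)
      rw [abs_mul, abs_of_nonneg hτ.1]
      nlinarith [hτ.2, abs_nonneg z]
    obtain ⟨h1, h2⟩ := hbd _ (ξ + τ • ζ) hsz
    have hn : ‖ξ + τ • ζ‖ ≤ ‖ξ‖ + ‖ζ‖ := by
      refine (norm_add_le _ _).trans (add_le_add le_rfl ?_)
      rw [norm_smul, Real.norm_of_nonneg hτ.1]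
      nlinarith [hτ.2, norm_nonneg ζ]
    have hn2 : ‖ξ + τ • ζ‖ ^ 2 ≤ 2 * (‖ξ‖ ^ 2 + ‖ζ‖ ^ 2) := by
      nlinarith [norm_nonneg (ξ + τ • ζ), sq_nonneg (‖ξ‖ - ‖ζ‖)]
    have a1 : |jS j x (s + τ * z) (ξ + τ • ζ) * z| ≤ 2 * Γ * L * (‖ξ‖ ^ 2 + ‖ζ‖ ^ 2) := by
      rw [abs_mul]
      calc _ ≤ (Γ * (2 * (‖ξ‖ ^ 2 + ‖ζ‖ ^ 2))) * L :=
            mul_le_mul (h1.trans (by gcongr)) hz (abs_nonneg _) (by positivity)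
        _ = _ := by ring
    have a2 : |inner ℝ (jXi j x (s + τ * z) (ξ + τ • ζ)) ζ| ≤ 2 * M * (‖ξ‖ ^ 2 + ‖ζ‖ ^ 2) := by
      calc _ ≤ ‖jXi j x (s + τ * z) (ξ + τ • ζ)‖ * ‖ζ‖ := abs_real_inner_le_norm _ _
        _ ≤ (M * (‖ξ‖ + ‖ζ‖)) * ‖ζ‖ := by
            refine mul_le_mul_of_nonneg_right (h2.trans (by gcongr)) (norm_nonneg _)
        _ = M * ((‖ξ‖ + ‖ζ‖) * ‖ζ‖) := by ring
        _ ≤ M * (2 * (‖ξ‖ ^ 2 + ‖ζ‖ ^ 2)) := by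
            refine mul_le_mul_of_nonneg_left ?_ hM
            nlinarith [sq_nonneg (‖ξ‖ - ‖ζ‖), sq_nonneg ‖ξ‖, sq_nonneg ‖ζ‖]
        _ = _ := by ring
    rw [Real.norm_eq_abs]
    refine (abs_add_le _ _).trans ?_
    linarith
  have := (convex_Icc (0 : ℝ) 1).norm_image_sub_le_of_norm_hasDerivWithin_le
    (f := fun t : ℝ => j x (s + t * z) (ξ + t • ζ))
    (fun τ _ => (hasDerivAt_integrand_line h s z ξ ζ τ).hasDerivWithinAt) hderiv
    (left_mem_Icc.2 zero_le_one) ht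
  simp only [zero_mul, add_zero, zero_smul, sub_zero, Real.norm_eq_abs, abs_of_nonneg ht.1] at this
  linarith

/-- Monotonicity of the gradient of a convex function minimal at the origin. -/
theorem inner_jXi_self_nonneg
    (h : ContDiff ℝ 1 (fun p : ℝ × EuclideanSpace ℝ (Fin N) => j x p.1 p.2)) {s : ℝ}
    (hconv : ConvexOn ℝ univ (fun ξ => j x s ξ)) (h0 : ∀ ξ, j x s 0 ≤ j x s ξ)
    (ξ : EuclideanSpace ℝ (Fin N)) : 0 ≤ inner ℝ (jXi j x s ξ) ξ := by
  have hd : HasDerivAt (fun t : ℝ => j x s (t • ξ)) (inner ℝ (jXi j x s ξ) ξ) 1 := by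
    have := hasDerivAt_integrand_line h s 0 0 ξ 1
    simpa using this
  have hc : ConvexOn ℝ univ (fun t : ℝ => j x s (t • ξ)) := by
    have := hconv.comp_linearMap (LinearMap.toSpanSingleton ℝ _ ξ)
    simpa [Function.comp_def] using this
  -- The derivative at $t=1$ dominates the secant slope over $[0,1]$, which is
  -- $j(x,s,\xi)-j(x,s,0)$.
  have := hc.slope_le_of_hasDerivAt (mem_univ 0) (mem_univ 1) zero_lt_one hd
  refine le_trans ?_ this
  simp only [slope_def_field, one_smul, zero_smul, sub_zero, div_one]
  linarith [h0 ξ]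

/-- Under the sign condition, `j` decreases along the scaling `(s, ξ) ↦ ((1 - t) s, (1 - t) ξ)`
as long as `|(1 - t) s| ≥ R`. -/
theorem integrand_scaling_le
    (h : ContDiff ℝ 1 (fun p : ℝ × EuclideanSpace ℝ (Fin N) => j x p.1 p.2))
    (hconv : ∀ s, ConvexOn ℝ univ (fun ξ => j x s ξ)) (h0 : ∀ s ξ, j x s 0 ≤ j x s ξ)
    {ε R : ℝ} (hε : 0 ≤ ε)
    (hsign : ∀ s ξ, R ≤ |s| → 0 ≤ (1 - ε) * inner ℝ (jXi j x s ξ) ξ + jS j x s ξ * s)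
    {s t : ℝ} (hs : 2 * R ≤ |s|) (ht : t ∈ Icc (0 : ℝ) (1 / 2)) (ξ : EuclideanSpace ℝ (Fin N)) :
    j x (s + t * -s) (ξ + t • -ξ) ≤ j x s ξ := by
  have hanti : AntitoneOn (fun t : ℝ => j x (s + t * -s) (ξ + t • -ξ)) (Icc 0 (1 / 2)) := by
    refine antitoneOn_of_hasDerivWithinAt_nonpos (convex_Icc _ _)
      (fun τ _ => (hasDerivAt_integrand_line h s (-s) ξ (-ξ) τ).continuousAt.continuousWithinAt)
      (fun τ _ => (hasDerivAt_integrand_line h s (-s) ξ (-ξ) τ).hasDerivWithinAt) ?_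
    intro τ hτ
    rw [interior_Icc] at hτ
    have hpos : 0 < 1 - τ := by linarith [hτ.2]
    have e1 : s + τ * -s = (1 - τ) * s := by ring
    have e2 : ξ + τ • -ξ = (1 - τ) • ξ := by module
    -- The threshold $2R$ is matched to $\tau<1/2$: the scaled value stays in the range of the sign
    -- condition.
    have hR : R ≤ |(1 - τ) * s| := by
      rw [abs_mul, abs_of_pos hpos]
      nlinarith [hτ.2, abs_nonneg s]
    have hs1 := hsign ((1 - τ) * s) ((1 - τ) • ξ) hR
    have hs2 := inner_jXi_self_nonneg h (hconv ((1 - τ) * s)) (h0 _) ((1 - τ) • ξ)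
    rw [e1, e2, inner_neg_right]
    rw [inner_smul_right] at hs1 hs2
    have hs3 := nonneg_of_mul_nonneg_right hs2 hpos
    have : 0 ≤ (1 - τ) * ((1 - ε) * inner ℝ (jXi j x ((1 - τ) * s) ((1 - τ) • ξ)) ξ
        + jS j x ((1 - τ) * s) ((1 - τ) • ξ) * s) := by linarith
    have := nonneg_of_mul_nonneg_right this hpos
    -- Adding $\varepsilon\,j_\xi\cdot\xi\ge0$ to the sign condition gives $j_\xi\cdot\xi+j_s
    -- s\ge0$, up to the positive factor $1-\tau$.
    nlinarith [mul_nonneg hε hs3]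
  simpa using hanti (left_mem_Icc.2 (by norm_num)) ht ht.1

end Integrand

/-! ### From difference quotients to integral inequalities. -/

/-- The integrals of `h₀` and `h₁` may be infinite, so they cannot be subtracted. Instead
$h_1+t(-q+G)=h_0+tG$, with $q=(h_1-h_0)/t$, is integrated as an identity between nonnegative terms,
and the finite quantity $t\int G$ is cancelled. -/
theorem lintegral_add_le_of_quotient {X : Type*} [MeasurableSpace X] {ν : Measure X}
    {h₀ h₁ G : X → ℝ} {t β : ℝ} (hm0 : AEMeasurable h₀ ν) (hm1 : AEMeasurable h₁ ν)
    (hn0 : ∀ᵐ x ∂ν, 0 ≤ h₀ x) (hn1 : ∀ᵐ x ∂ν, 0 ≤ h₁ x) (hG : Integrable G ν)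
    (hG0 : ∀ x, 0 ≤ G x) (ht : 0 < t) (hβ : 0 ≤ β) (hle : ∀ᵐ x ∂ν, h₁ x ≤ h₀ x + t * G x)
    (hβle : ENNReal.ofReal (β + ∫ x, G x ∂ν)
      ≤ ∫⁻ x, ENNReal.ofReal (-((h₁ x - h₀ x) / t) + G x) ∂ν) :
    (∫⁻ x, ENNReal.ofReal (h₁ x) ∂ν) + ENNReal.ofReal (β * t) ≤ ∫⁻ x, ENNReal.ofReal (h₀ x) ∂ν := by
  have hFm : AEMeasurable (fun x => ENNReal.ofReal (-((h₁ x - h₀ x) / t) + G x)) ν :=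
    (((hm1.sub hm0).div_const t).neg.add hG.aemeasurable).ennreal_ofReal
  have hsplit : ∫⁻ x, ENNReal.ofReal (h₁ x)
        + ENNReal.ofReal t * ENNReal.ofReal (-((h₁ x - h₀ x) / t) + G x) ∂ν
      = ∫⁻ x, ENNReal.ofReal (h₀ x) + ENNReal.ofReal t * ENNReal.ofReal (G x) ∂ν := by
    refine lintegral_congr_ae ?_
    filter_upwards [hle, hn0, hn1] with x hx hx0 hx1
    have hpos : 0 ≤ -((h₁ x - h₀ x) / t) + G x := by
      have : -((h₁ x - h₀ x) / t) + G x = (h₀ x + t * G x - h₁ x) / t := by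
        field_simp
        ring
      rw [this]
      exact div_nonneg (sub_nonneg.2 hx) ht.le
    rw [← ENNReal.ofReal_mul ht.le, ← ENNReal.ofReal_mul ht.le,
      ← ENNReal.ofReal_add hx1 (mul_nonneg ht.le hpos),
      ← ENNReal.ofReal_add hx0 (mul_nonneg ht.le (hG0 x))]
    congr 1
    field_simp
    ring
  rw [lintegral_add_left' hm1.ennreal_ofReal, lintegral_add_left' hm0.ennreal_ofReal,
    lintegral_const_mul'' _ hFm, lintegral_const_mul'' _ hG.aemeasurable.ennreal_ofReal,
    ← ofReal_integral_eq_lintegral_ofReal hG (.of_forall hG0)] at hsplit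
  refine ENNReal.le_of_add_le_add_right (a := ENNReal.ofReal t * ENNReal.ofReal (∫ x, G x ∂ν))
    (ENNReal.mul_ne_top ENNReal.ofReal_ne_top ENNReal.ofReal_ne_top) ?_
  rw [← hsplit, add_assoc]
  gcongr
  rw [mul_comm β, ENNReal.ofReal_mul ht.le, ← mul_add,
    ← ENNReal.ofReal_add hβ (integral_nonneg hG0)]
  gcongr

/-- Integrability of `q` is not known beforehand: it follows from the finite integral of the
nonnegative function $-q+G$ and the integrability of `G`. -/
theorem integrable_and_neg_le_integral_of_lintegral {X : Type*} [MeasurableSpace X] {ν : Measure X}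
    {q G : X → ℝ} {B : ℝ} (hq : AEMeasurable q ν) (hG : Integrable G ν) (hG0 : ∀ x, 0 ≤ G x)
    (hqG : ∀ᵐ x ∂ν, 0 ≤ -q x + G x) (hB : 0 ≤ B)
    (h : ∫⁻ x, ENNReal.ofReal (-q x + G x) ∂ν ≤ ENNReal.ofReal (B + ∫ x, G x ∂ν)) :
    Integrable q ν ∧ -B ≤ ∫ x, q x ∂ν := by
  have hint : Integrable (fun x => -q x + G x) ν := by
    refine ⟨(hq.neg.add hG.aemeasurable).aestronglyMeasurable, ?_⟩
    rw [hasFiniteIntegral_iff_ofReal hqG]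
    exact h.trans_lt ENNReal.ofReal_lt_top
  have hqint : Integrable q ν := by
    refine (hG.sub hint).congr (.of_forall fun x => ?_)
    simp
  refine ⟨hqint, ?_⟩
  have hg0 : 0 ≤ ∫ x, G x ∂ν := integral_nonneg hG0
  rw [← ofReal_integral_eq_lintegral_ofReal hint hqG,
    ENNReal.ofReal_le_ofReal_iff (by positivity), integral_add (f := fun x => -q x) hqint.neg hG,
    integral_neg] at h
  linarith

/-! ### The slope of the energy bounds its derivative along continuous fields. -/

section Slope

variable {N : ℕ} {Ω : Set (EuclideanSpace ℝ (Fin N))}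
  {j : EuclideanSpace ℝ (Fin N) → ℝ → EuclideanSpace ℝ (Fin N) → ℝ}

theorem L2Pair.continuous_fst : Continuous fun p : L2Pair Ω => p.fst :=
  _root_.continuous_fst.comp (WithLp.prod_continuous_ofLp 2 _ _)

theorem L2Pair.continuous_snd : Continuous fun p : L2Pair Ω => p.snd :=
  _root_.continuous_snd.comp (WithLp.prod_continuous_ofLp 2 _ _)

/-- A convergent sequence of pairs has a subsequence converging almost everywhere. -/
theorem L2Pair.exists_subseq_ae {p : ℕ → L2Pair Ω} {q : L2Pair Ω}
    (h : Tendsto p atTop (𝓝 q)) :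
    ∃ φ : ℕ → ℕ, StrictMono φ ∧ ∀ᵐ x ∂volume.restrict Ω,
      Tendsto (fun n => (p (φ n)).fst x) atTop (𝓝 (q.fst x)) ∧
      Tendsto (fun n => (p (φ n)).snd x) atTop (𝓝 (q.snd x)) := by
  obtain ⟨φ, hφ, h1⟩ := (tendstoInMeasure_of_tendsto_Lp
    ((L2Pair.continuous_fst.tendsto q).comp h)).exists_seq_tendsto_ae
  obtain ⟨ψ, hψ, h2⟩ := (tendstoInMeasure_of_tendsto_Lp
    ((L2Pair.continuous_snd.tendsto q).comp (h.comp hφ.tendsto_atTop))).exists_seq_tendsto_ae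
  refine ⟨φ ∘ ψ, hφ.comp hψ, ?_⟩
  filter_upwards [h1, h2] with x hx1 hx2
  exact ⟨hx1.comp hψ.tendsto_atTop, hx2⟩

theorem integrable_sq_norm_Lp (f : Lp (EuclideanSpace ℝ (Fin N)) 2 (volume.restrict Ω)) :
    Integrable (fun x => ‖f x‖ ^ 2) (volume.restrict Ω) :=
  (Lp.memLp f).integrable_norm_pow (p := 2) two_ne_zero

theorem integral_sq_norm_Lp (f : Lp (EuclideanSpace ℝ (Fin N)) 2 (volume.restrict Ω)) :
    ∫ x in Ω, ‖f x‖ ^ 2 = ‖f‖ ^ 2 := by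
  rw [← real_inner_self_eq_norm_sq, L2.inner_def]
  simp_rw [real_inner_self_eq_norm_sq]

theorem integrable_gradient_sq (C : ℝ) (v w : H10 Ω) :
    Integrable (fun x => C * (‖h10Grad v x‖ ^ 2 + ‖h10Grad w x‖ ^ 2)) (volume.restrict Ω) :=
  ((integrable_sq_norm_Lp v.1.snd).add (integrable_sq_norm_Lp w.1.snd)).const_mul C

theorem integral_gradient_sq (C : ℝ) (v w : H10 Ω) :
    ∫ x in Ω, C * (‖h10Grad v x‖ ^ 2 + ‖h10Grad w x‖ ^ 2)
      = C * (‖v.1.snd‖ ^ 2 + ‖w.1.snd‖ ^ 2) := by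
  rw [integral_const_mul, ← integral_sq_norm_Lp, ← integral_sq_norm_Lp, ← integral_add]
  · rfl
  · exact integrable_sq_norm_Lp v.1.snd
  · exact integrable_sq_norm_Lp w.1.snd

theorem h10Val_add_smul (v w : H10 Ω) (t : ℝ) :
    ∀ᵐ x ∂volume.restrict Ω, h10Val (v + t • w) x = h10Val v x + t * h10Val w x := by
  filter_upwards [Lp.coeFn_add v.1.fst (t • w.1.fst), Lp.coeFn_smul t w.1.fst] with x h1 h2
  change (v.1.fst + t • w.1.fst) x = _
  rw [h1, Pi.add_apply, h2]
  rfl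

theorem h10Grad_add_smul (v w : H10 Ω) (t : ℝ) :
    ∀ᵐ x ∂volume.restrict Ω, h10Grad (v + t • w) x = h10Grad v x + t • h10Grad w x := by
  filter_upwards [Lp.coeFn_add v.1.snd (t • w.1.snd), Lp.coeFn_smul t w.1.snd] with x h1 h2
  change (v.1.snd + t • w.1.snd) x = _
  rw [h1, Pi.add_apply, h2]
  rfl

theorem aestronglyMeasurable_h10Val (v : H10 Ω) :
    AEStronglyMeasurable (h10Val v) (volume.restrict Ω) := Lp.aestronglyMeasurable v.1.fst

theorem aestronglyMeasurable_h10Grad (v : H10 Ω) :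
    AEStronglyMeasurable (h10Grad v) (volume.restrict Ω) := Lp.aestronglyMeasurable v.1.snd

theorem aemeasurable_integrand (hj_meas : ∀ s ξ, AEMeasurable (fun x => j x s ξ) (volume.restrict Ω))
    (hj_C1 : ∀ᵐ x ∂volume.restrict Ω,
      ContDiff ℝ 1 (fun p : ℝ × EuclideanSpace ℝ (Fin N) => j x p.1 p.2))
    {a : EuclideanSpace ℝ (Fin N) → ℝ} {b : EuclideanSpace ℝ (Fin N) → EuclideanSpace ℝ (Fin N)}
    (ha : AEStronglyMeasurable a (volume.restrict Ω))
    (hb : AEStronglyMeasurable b (volume.restrict Ω)) :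
    AEMeasurable (fun x => j x (a x) (b x)) (volume.restrict Ω) :=
  aemeasurable_comp_caratheodory (F := fun x (p : ℝ × EuclideanSpace ℝ (Fin N)) => j x p.1 p.2)
    (fun p => hj_meas p.1 p.2) (hj_C1.mono fun _ h => h.continuous) (ha.prodMk hb)

theorem aemeasurable_integrand_add_smul
    (hj_meas : ∀ s ξ, AEMeasurable (fun x => j x s ξ) (volume.restrict Ω))
    (hj_C1 : ∀ᵐ x ∂volume.restrict Ω,
      ContDiff ℝ 1 (fun p : ℝ × EuclideanSpace ℝ (Fin N) => j x p.1 p.2))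
    {a c : EuclideanSpace ℝ (Fin N) → ℝ}
    {b d : EuclideanSpace ℝ (Fin N) → EuclideanSpace ℝ (Fin N)}
    (ha : AEStronglyMeasurable a (volume.restrict Ω))
    (hb : AEStronglyMeasurable b (volume.restrict Ω))
    (hc : AEStronglyMeasurable c (volume.restrict Ω))
    (hd : AEStronglyMeasurable d (volume.restrict Ω)) (t : ℝ) :
    AEMeasurable (fun x => j x (a x + t * c x) (b x + t • d x)) (volume.restrict Ω) := by
  have h1 : AEStronglyMeasurable (fun x => a x + t * c x) (volume.restrict Ω) :=
    ha.add (hc.const_mul t)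
  have h2 : AEStronglyMeasurable (fun x => b x + t • d x) (volume.restrict Ω) :=
    hb.add (hd.const_smul t)
  exact aemeasurable_integrand hj_meas hj_C1 h1 h2

theorem aemeasurable_integrand_quotient
    (hj_meas : ∀ s ξ, AEMeasurable (fun x => j x s ξ) (volume.restrict Ω))
    (hj_C1 : ∀ᵐ x ∂volume.restrict Ω,
      ContDiff ℝ 1 (fun p : ℝ × EuclideanSpace ℝ (Fin N) => j x p.1 p.2))
    {a c : EuclideanSpace ℝ (Fin N) → ℝ}
    {b d : EuclideanSpace ℝ (Fin N) → EuclideanSpace ℝ (Fin N)}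
    (ha : AEStronglyMeasurable a (volume.restrict Ω))
    (hb : AEStronglyMeasurable b (volume.restrict Ω))
    (hc : AEStronglyMeasurable c (volume.restrict Ω))
    (hd : AEStronglyMeasurable d (volume.restrict Ω)) (t : ℝ) :
    AEMeasurable (fun x => (j x (a x + t * c x) (b x + t • d x) - j x (a x) (b x)) / t)
      (volume.restrict Ω) :=
  ((aemeasurable_integrand_add_smul hj_meas hj_C1 ha hb hc hd t).sub
    (aemeasurable_integrand hj_meas hj_C1 ha hb)).div_const t

/-- Measurability passes to the limit of the difference quotients with step $1/(n+1)$. -/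
theorem aemeasurable_derivative
    (hj_meas : ∀ s ξ, AEMeasurable (fun x => j x s ξ) (volume.restrict Ω))
    (hj_C1 : ∀ᵐ x ∂volume.restrict Ω,
      ContDiff ℝ 1 (fun p : ℝ × EuclideanSpace ℝ (Fin N) => j x p.1 p.2))
    {a c : EuclideanSpace ℝ (Fin N) → ℝ}
    {b d : EuclideanSpace ℝ (Fin N) → EuclideanSpace ℝ (Fin N)}
    (ha : AEStronglyMeasurable a (volume.restrict Ω))
    (hb : AEStronglyMeasurable b (volume.restrict Ω))
    (hc : AEStronglyMeasurable c (volume.restrict Ω))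
    (hd : AEStronglyMeasurable d (volume.restrict Ω)) :
    AEMeasurable (fun x => jS j x (a x) (b x) * c x + inner ℝ (jXi j x (a x) (b x)) (d x))
      (volume.restrict Ω) := by
  have ht : Tendsto (fun n : ℕ => 1 / ((n : ℝ) + 1)) atTop (𝓝[>] 0) :=
    tendsto_nhdsWithin_iff.2 ⟨tendsto_one_div_add_atTop_nhds_zero_nat,
      .of_forall fun n => by simp only [mem_Ioi]; positivity⟩
  refine aemeasurable_of_tendsto_metrizable_ae atTop
    (f := fun (n : ℕ) x => (j x (a x + 1 / ((n : ℝ) + 1) * c x) (b x + (1 / ((n : ℝ) + 1)) • d x)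
      - j x (a x) (b x)) / (1 / ((n : ℝ) + 1))) (fun n => ?_) ?_
  · exact aemeasurable_integrand_quotient hj_meas hj_C1 ha hb hc hd _
  · filter_upwards [hj_C1] with x hx
    exact tendsto_integrand_quotient hx tendsto_const_nhds tendsto_const_nhds tendsto_const_nhds
      tendsto_const_nhds ht

/-- The energy decrease along a field, provided the averaged difference quotient is large. -/
theorem energy_add_smul_le
    (hj_meas : ∀ s ξ, AEMeasurable (fun x => j x s ξ) (volume.restrict Ω))
    (hj_C1 : ∀ᵐ x ∂volume.restrict Ω,
      ContDiff ℝ 1 (fun p : ℝ × EuclideanSpace ℝ (Fin N) => j x p.1 p.2))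
    (hj_nonneg : ∀ᵐ x ∂volume.restrict Ω, ∀ s ξ, 0 ≤ j x s ξ)
    {v w : H10 Ω} {t β C : ℝ} (ht : 0 < t) (hβ : 0 ≤ β) (hC : 0 ≤ C)
    (hle : ∀ᵐ x ∂volume.restrict Ω,
      j x (h10Val v x + t * h10Val w x) (h10Grad v x + t • h10Grad w x)
        ≤ j x (h10Val v x) (h10Grad v x)
          + t * (C * (‖h10Grad v x‖ ^ 2 + ‖h10Grad w x‖ ^ 2)))
    (hβle : ENNReal.ofReal (β + C * (‖v.1.snd‖ ^ 2 + ‖w.1.snd‖ ^ 2))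
      ≤ ∫⁻ x in Ω, ENNReal.ofReal
        (-((j x (h10Val v x + t * h10Val w x) (h10Grad v x + t • h10Grad w x)
          - j x (h10Val v x) (h10Grad v x)) / t)
          + C * (‖h10Grad v x‖ ^ 2 + ‖h10Grad w x‖ ^ 2))) :
    energy Ω j (v + t • w) + ((β * t : ℝ) : EReal) ≤ energy Ω j v := by
  have hE1 : ∫⁻ x in Ω, ENNReal.ofReal (j x (h10Val (v + t • w) x) (h10Grad (v + t • w) x))
      = ∫⁻ x in Ω, ENNReal.ofReal
        (j x (h10Val v x + t * h10Val w x) (h10Grad v x + t • h10Grad w x)) := by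
    refine lintegral_congr_ae ?_
    filter_upwards [h10Val_add_smul v w t, h10Grad_add_smul v w t] with x e1 e2
    rw [e1, e2]
  have hcoe : ((β * t : ℝ) : EReal) = ((ENNReal.ofReal (β * t) : ℝ≥0∞) : EReal) := by
    rw [EReal.coe_ennreal_ofReal, max_eq_left (by positivity)]
  rw [energy, energy, hE1, hcoe, ← EReal.coe_ennreal_add, EReal.coe_ennreal_le_coe_ennreal_iff]
  rw [← integral_gradient_sq] at hβle
  exact lintegral_add_le_of_quotient
    (aemeasurable_integrand hj_meas hj_C1 (aestronglyMeasurable_h10Val v)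
      (aestronglyMeasurable_h10Grad v))
    (aemeasurable_integrand_add_smul hj_meas hj_C1 (aestronglyMeasurable_h10Val v)
      (aestronglyMeasurable_h10Grad v) (aestronglyMeasurable_h10Val w)
      (aestronglyMeasurable_h10Grad w) t)
    (hj_nonneg.mono fun x h => h _ _) (hj_nonneg.mono fun x h => h _ _)
    (integrable_gradient_sq C v w) (fun x => by positivity) ht hβ hle hβle

/-- Lower semicontinuity of the averaged difference quotients along a continuous field, by
Fatou's lemma with a varying integrable minorant. -/
theorem eventually_le_lintegral_quotient
    (hj_meas : ∀ s ξ, AEMeasurable (fun x => j x s ξ) (volume.restrict Ω))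
    (hj_C1 : ∀ᵐ x ∂volume.restrict Ω,
      ContDiff ℝ 1 (fun p : ℝ × EuclideanSpace ℝ (Fin N) => j x p.1 p.2))
    {Z : H10 Ω → H10 Ω} (hZ : Continuous Z) (u : H10 Ω) {β C : ℝ}
    (hβ : ENNReal.ofReal (β + C * (‖u.1.snd‖ ^ 2 + ‖(Z u).1.snd‖ ^ 2))
      < ∫⁻ x in Ω, ENNReal.ofReal
        (-(jS j x (h10Val u x) (h10Grad u x) * h10Val (Z u) x
          + inner ℝ (jXi j x (h10Val u x) (h10Grad u x)) (h10Grad (Z u) x))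
          + C * (‖h10Grad u x‖ ^ 2 + ‖h10Grad (Z u) x‖ ^ 2))) :
    ∀ᶠ p : H10 Ω × ℝ in 𝓝 u ×ˢ 𝓝[>] 0,
      ENNReal.ofReal (β + C * (‖p.1.1.snd‖ ^ 2 + ‖(Z p.1).1.snd‖ ^ 2))
      ≤ ∫⁻ x in Ω, ENNReal.ofReal
        (-((j x (h10Val p.1 x + p.2 * h10Val (Z p.1) x)
            (h10Grad p.1 x + p.2 • h10Grad (Z p.1) x)
          - j x (h10Val p.1 x) (h10Grad p.1 x)) / p.2)
          + C * (‖h10Grad p.1 x‖ ^ 2 + ‖h10Grad (Z p.1) x‖ ^ 2)) := by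
  by_contra hcon
  -- Failure yields a sequence violating the bound; along a subsequence the functions, the fields
  -- and both gradients converge almost everywhere, as Fatou's lemma requires.
  obtain ⟨p, hp, hpn⟩ := exists_seq_forall_of_frequently (not_eventually.1 hcon)
  rw [tendsto_prod_iff'] at hp
  obtain ⟨hp1, hp2⟩ := hp
  have hval : Tendsto (fun n => (p n).1.1) atTop (𝓝 u.1) :=
    (continuous_subtype_val.tendsto u).comp hp1
  have hZval : Tendsto (fun n => (Z (p n).1).1) atTop (𝓝 (Z u).1) :=
    ((continuous_subtype_val.comp hZ).tendsto u).comp hp1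
  obtain ⟨φ, hφ, hae1⟩ := L2Pair.exists_subseq_ae hval
  obtain ⟨ψ, hψ, hae2⟩ := L2Pair.exists_subseq_ae (hZval.comp hφ.tendsto_atTop)
  let k : ℕ → ℕ := φ ∘ ψ
  have hkt : Tendsto k atTop atTop := hφ.tendsto_atTop.comp hψ.tendsto_atTop
  let F : ℕ → EuclideanSpace ℝ (Fin N) → ℝ≥0∞ := fun n x => ENNReal.ofReal
        (-((j x (h10Val (p (k n)).1 x + (p (k n)).2 * h10Val (Z (p (k n)).1) x)
            (h10Grad (p (k n)).1 x + (p (k n)).2 • h10Grad (Z (p (k n)).1) x)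
          - j x (h10Val (p (k n)).1 x) (h10Grad (p (k n)).1 x)) / (p (k n)).2)
          + C * (‖h10Grad (p (k n)).1 x‖ ^ 2 + ‖h10Grad (Z (p (k n)).1) x‖ ^ 2))
  have hFm : ∀ n, AEMeasurable (F n) (volume.restrict Ω) := by
    intro n
    have hvm := aestronglyMeasurable_h10Val (p (k n)).1
    have hwm := aestronglyMeasurable_h10Val (Z (p (k n)).1)
    have hvg := aestronglyMeasurable_h10Grad (p (k n)).1
    have hwg := aestronglyMeasurable_h10Grad (Z (p (k n)).1)
    exact ((aemeasurable_integrand_quotient hj_meas hj_C1 hvm hvg hwm hwg _).neg.add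
      (integrable_gradient_sq C _ _).aemeasurable).ennreal_ofReal
  have hlim : ∀ᵐ x ∂volume.restrict Ω, liminf (fun n => F n x) atTop = ENNReal.ofReal
        (-(jS j x (h10Val u x) (h10Grad u x) * h10Val (Z u) x
          + inner ℝ (jXi j x (h10Val u x) (h10Grad u x)) (h10Grad (Z u) x))
          + C * (‖h10Grad u x‖ ^ 2 + ‖h10Grad (Z u) x‖ ^ 2)) := by
    filter_upwards [hae1, hae2, hj_C1] with x h1 h2 h3
    refine Tendsto.liminf_eq ((ENNReal.continuous_ofReal.tendsto _).comp ?_)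
    have hv := h1.1.comp hψ.tendsto_atTop
    have hg := h1.2.comp hψ.tendsto_atTop
    exact (tendsto_integrand_quotient h3 hv h2.1 hg h2.2 (hp2.comp hkt)).neg.add
      (((hg.norm.pow 2).add (h2.2.norm.pow 2)).const_mul C)
  -- The integral of the added majorant also converges, since `Z` is continuous into $H^1_0$; it
  -- therefore does not spoil the comparison of lower limits.
  have hbound : Tendsto (fun n => ENNReal.ofReal
      (β + C * (‖(p (k n)).1.1.snd‖ ^ 2 + ‖(Z (p (k n)).1).1.snd‖ ^ 2))) atTop
      (𝓝 (ENNReal.ofReal (β + C * (‖u.1.snd‖ ^ 2 + ‖(Z u).1.snd‖ ^ 2)))) := by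
    have a1 := (L2Pair.continuous_snd.tendsto u.1).comp (hval.comp hkt)
    have a2 := (L2Pair.continuous_snd.tendsto (Z u).1).comp (hZval.comp hkt)
    exact (ENNReal.continuous_ofReal.tendsto _).comp
      ((((a1.norm.pow 2).add (a2.norm.pow 2)).const_mul C).const_add β)
  refine absurd hβ (not_lt.2 ?_)
  calc _ = ∫⁻ x in Ω, liminf (fun n => F n x) atTop := (lintegral_congr_ae hlim).symm
    _ ≤ liminf (fun n => ∫⁻ x in Ω, F n x) atTop := lintegral_liminf_le' hFm
    _ ≤ liminf (fun n => ENNReal.ofReal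
      (β + C * (‖(p (k n)).1.1.snd‖ ^ 2 + ‖(Z (p (k n)).1).1.snd‖ ^ 2))) atTop :=
        liminf_le_liminf (.of_forall fun n => (not_le.1 (hpn (k n))).le)
    _ = _ := hbound.liminf_eq

/-- Along a continuous field `Z` for which the increments of the integrand are bounded above by
`t C (|∇v|² + |∇Z(v)|²)`, the derivative of the energy at `u` is integrable and bounded below by
`-|dI|(u) ‖Z(u)‖`. -/
theorem integral_derivative_le_weakSlope
    (hj_meas : ∀ s ξ, AEMeasurable (fun x => j x s ξ) (volume.restrict Ω))
    (hj_C1 : ∀ᵐ x ∂volume.restrict Ω,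
      ContDiff ℝ 1 (fun p : ℝ × EuclideanSpace ℝ (Fin N) => j x p.1 p.2))
    (hj_nonneg : ∀ᵐ x ∂volume.restrict Ω, ∀ s ξ, 0 ≤ j x s ξ)
    {Z : H10 Ω → H10 Ω} (hZ : Continuous Z) {C t₀ : ℝ} (hC : 0 ≤ C) (ht₀ : 0 < t₀)
    (hle : ∀ v, ∀ t ∈ Ioc 0 t₀, ∀ᵐ x ∂volume.restrict Ω,
      j x (h10Val v x + t * h10Val (Z v) x) (h10Grad v x + t • h10Grad (Z v) x)
        ≤ j x (h10Val v x) (h10Grad v x)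
          + t * (C * (‖h10Grad v x‖ ^ 2 + ‖h10Grad (Z v) x‖ ^ 2)))
    (u : H10 Ω) (hu : energy Ω j u ≠ ⊤) (hslope : weakSlope (energy Ω j) u hu < ⊤) :
    Integrable (fun x => jS j x (h10Val u x) (h10Grad u x) * h10Val (Z u) x
      + inner ℝ (jXi j x (h10Val u x) (h10Grad u x)) (h10Grad (Z u) x)) (volume.restrict Ω) ∧
    -((weakSlope (energy Ω j) u hu).toReal * ‖Z u‖) ≤
      ∫ x in Ω, (jS j x (h10Val u x) (h10Grad u x) * h10Val (Z u) x
        + inner ℝ (jXi j x (h10Val u x) (h10Grad u x)) (h10Grad (Z u) x)) := by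
  obtain ⟨c, hc⟩ : ∃ c : ℝ, (weakSlope (energy Ω j) u hu).toReal = c := ⟨_, rfl⟩
  have hc0 : 0 ≤ c := hc ▸ ENNReal.toReal_nonneg
  rw [hc]
  refine integrable_and_neg_le_integral_of_lintegral
    (aemeasurable_derivative hj_meas hj_C1 (aestronglyMeasurable_h10Val u)
      (aestronglyMeasurable_h10Grad u) (aestronglyMeasurable_h10Val _)
      (aestronglyMeasurable_h10Grad _)) (integrable_gradient_sq C u (Z u))
    (fun x => by positivity) ?_ (by positivity) ?_
  · -- the limit of the pointwise bounds at `u`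
    have ht : Tendsto (fun n : ℕ => t₀ / ((n : ℝ) + 1)) atTop (𝓝 0) := by
      simpa [div_eq_mul_inv] using
        (tendsto_one_div_add_atTop_nhds_zero_nat (𝕜 := ℝ)).const_mul t₀
    have htpos : ∀ n : ℕ, 0 < t₀ / ((n : ℝ) + 1) := fun n => by positivity
    have htmem : ∀ n : ℕ, t₀ / ((n : ℝ) + 1) ∈ Ioc 0 t₀ := fun n =>
      ⟨htpos n, div_le_self ht₀.le (by linarith [(Nat.cast_nonneg n : (0 : ℝ) ≤ n)])⟩
    filter_upwards [ae_all_iff.2 fun n : ℕ => hle u _ (htmem n), hj_C1] with x hx1 hx2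
    have hlim := tendsto_integrand_quotient hx2 (l := atTop) (tendsto_const_nhds (x := h10Val u x))
      (tendsto_const_nhds (x := h10Val (Z u) x)) (tendsto_const_nhds (x := h10Grad u x))
      (tendsto_const_nhds (x := h10Grad (Z u) x))
      (tendsto_nhdsWithin_iff.2 ⟨ht, .of_forall htpos⟩)
    have := le_of_tendsto (b := C * (‖h10Grad u x‖ ^ 2 + ‖h10Grad (Z u) x‖ ^ 2)) hlim
      (.of_forall fun n => (div_le_iff₀ (htpos n)).2 (by linarith [hx1 n]))
    linarith
  -- This covers a non-integrable derivative as well, the right-hand side then being infinite. The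
  -- strict gap leaves room for some $r>0$ with descent rate $(c+r)(\|Z(u)\|+r)$ near $u$, which
  -- would force the slope to be at least $c+r$. The same $r$ keeps the norm bound positive when
  -- $Z(u)=0$.
  · by_contra! hlt
    rw [integral_gradient_sq] at hlt
    obtain ⟨g, hg⟩ : ∃ g, C * (‖u.1.snd‖ ^ 2 + ‖(Z u).1.snd‖ ^ 2) = g := ⟨_, rfl⟩
    rw [hg] at hlt
    have hcont : Tendsto (fun r : ℝ => ENNReal.ofReal ((c + r) * (‖Z u‖ + r) + g)) (𝓝[>] 0)
        (𝓝 (ENNReal.ofReal (c * ‖Z u‖ + g))) := by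
      have : Continuous fun r : ℝ => ENNReal.ofReal ((c + r) * (‖Z u‖ + r) + g) :=
        ENNReal.continuous_ofReal.comp (by fun_prop)
      simpa using (this.tendsto 0).mono_left nhdsWithin_le_nhds
    obtain ⟨r, hr1, hr2⟩ :=
      ((hcont.eventually_lt_const hlt).and (self_mem_nhdsWithin (s := Ioi (0 : ℝ)))).exists
    rw [← hg] at hr1
    have hbpos : 0 < ‖Z u‖ + r := by positivity
    have hev := eventually_le_lintegral_quotient hj_meas hj_C1 hZ u hr1
    obtain ⟨pa, hpa, pb, hpb, hab⟩ := eventually_prod_iff.1 hev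
    have hZn : ∀ᶠ v in 𝓝 u, ‖Z v‖ < ‖Z u‖ + r :=
      (hZ.norm.tendsto u).eventually_lt_const (by linarith)
    obtain ⟨δ₁, hδ₁, hball⟩ := Metric.eventually_nhds_iff_ball.1 (hpa.and hZn)
    obtain ⟨δ₂, hδ₂, hIoo⟩ := mem_nhdsGT_iff_exists_Ioo_subset.1 hpb
    have hδ₂ : 0 < δ₂ := hδ₂
    have hfin : ENNReal.ofReal (c + r) ≤ weakSlope (energy Ω j) u hu := by
      -- Half of `δ₂` is taken because `t` may equal the radius, while the interval of good times is
      -- open at `δ₂`.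
      refine le_weakSlope_of_deformation hu hZ (δ := min δ₁ (min (δ₂ / 2) t₀)) hbpos (by positivity)
        (by positivity) ?_ ?_
      · intro v hv
        exact (hball v (Metric.ball_subset_ball (min_le_left _ _) hv)).2.le
      · intro v hv t ht
        rcases ht.1.eq_or_lt with rfl | htpos
        · simp
        · have h1 := (hball v (Metric.ball_subset_ball (min_le_left _ _) hv)).1
          have h2 : t ≤ min (δ₂ / 2) t₀ := ht.2.trans (min_le_right _ _)
          have h3 := hab h1 (hIoo ⟨htpos, by linarith [h2.trans (min_le_left _ _)]⟩)
          exact energy_add_smul_le hj_meas hj_C1 hj_nonneg htpos (by positivity) hC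
            (hle v t ⟨htpos, h2.trans (min_le_right _ _)⟩) h3
    rw [ENNReal.ofReal_le_iff_le_toReal hslope.ne, hc] at hfin
    linarith

end Slope

/-! ### Nonlinear composition in $H^1_0(\Omega)$. -/

section Composition

variable {N : ℕ} {Ω : Set (EuclideanSpace ℝ (Fin N))}

/-- Multiplication by a bounded continuous function of an `L²` function is jointly continuous. -/
theorem exists_continuous_smul_Lp {a : ℝ × ℝ → ℝ} (ha : Continuous a) {M : ℝ}
    (hM : ∀ y, |a y| ≤ M) :
    ∃ Q : Lp (ℝ × ℝ) 2 (volume.restrict Ω) →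
        Lp (EuclideanSpace ℝ (Fin N)) 2 (volume.restrict Ω) →
        Lp (EuclideanSpace ℝ (Fin N)) 2 (volume.restrict Ω),
      Continuous (Function.uncurry Q) ∧
      ∀ f g, ∀ᵐ x ∂volume.restrict Ω, Q f g x = a (f x) • g x := by
  have hmem : ∀ (f : Lp (ℝ × ℝ) 2 (volume.restrict Ω))
      (g : Lp (EuclideanSpace ℝ (Fin N)) 2 (volume.restrict Ω)),
      MemLp (fun x => a (f x) • g x) 2 (volume.restrict Ω) := by
    intro f g
    refine MemLp.of_le_mul (c := M) (Lp.memLp g)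
      ((ha.comp_aestronglyMeasurable (Lp.aestronglyMeasurable f)).smul
        (Lp.aestronglyMeasurable g)) (.of_forall fun x => ?_)
    rw [norm_smul]
    exact mul_le_mul_of_nonneg_right (hM _) (norm_nonneg _)
  let Q := fun f g => (hmem f g).toLp _
  have hQ : ∀ f g, ∀ᵐ x ∂volume.restrict Ω, Q f g x = a (f x) • g x :=
    fun f g => (hmem f g).coeFn_toLp
  refine ⟨Q, ?_, hQ⟩
  rw [continuous_iff_seqContinuous]
  intro p q hpq
  -- Along a subsequence with $f_n\to f$ a.e., the difference splits in two: changing $g$ costs at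
  -- most $M\|g_n-g\|$, and changing $f$ is handled by dominated convergence with
  -- $|(a(f_n)-a(f))g|\le 2M|g|$.
  refine tendsto_of_subseq_tendsto fun ns hns => ?_
  have hpn := hpq.comp hns
  obtain ⟨ms, hms, hae⟩ := (tendstoInMeasure_of_tendsto_Lp
    ((continuous_fst.tendsto q).comp hpn)).exists_seq_tendsto_ae
  refine ⟨ms, ?_⟩
  have hpm : Tendsto (fun n => p (ns (ms n))) atTop (𝓝 q) := hpn.comp hms.tendsto_atTop
  have hfirst : Tendsto (fun n => M * ‖(p (ns (ms n))).2 - q.2‖) atTop (𝓝 0) := by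
    have := ((((continuous_snd.tendsto q).comp hpm).sub_const q.2).norm).const_mul M
    simpa using this
  have hsecond : Tendsto (fun n => ‖Q (p (ns (ms n))).1 q.2 - Q q.1 q.2‖ ^ 2) atTop (𝓝 0) := by
    simp_rw [← integral_sq_norm_Lp]
    have hpt : ∀ n, ∀ᵐ x ∂volume.restrict Ω, (Q (p (ns (ms n))).1 q.2 - Q q.1 q.2) x
        = (a ((p (ns (ms n))).1 x) - a (q.1 x)) • q.2 x := by
      intro n
      filter_upwards [Lp.coeFn_sub (Q (p (ns (ms n))).1 q.2) (Q q.1 q.2),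
        hQ (p (ns (ms n))).1 q.2, hQ q.1 q.2] with x h1 h2 h3
      rw [h1, Pi.sub_apply, h2, h3, sub_smul]
    have h0 : (0 : ℝ) = ∫ _ in Ω, (0 : ℝ) ∂(volume : Measure (EuclideanSpace ℝ (Fin N))) := by
      simp
    rw [h0]
    refine tendsto_integral_of_dominated_convergence (fun x => (2 * M) ^ 2 * ‖q.2 x‖ ^ 2)
      (fun n => (integrable_sq_norm_Lp _).aestronglyMeasurable)
      ((integrable_sq_norm_Lp q.2).const_mul _) (fun n => ?_) ?_
    · filter_upwards [hpt n] with x hx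
      rw [hx, norm_smul, Real.norm_of_nonneg (by positivity), mul_pow]
      gcongr
      rw [Real.norm_eq_abs]
      refine (abs_sub _ _).trans ?_
      linarith [hM ((p (ns (ms n))).1 x), hM (q.1 x)]
    · filter_upwards [ae_all_iff.2 hpt, hae] with x hx1 hx2
      have h3 : Tendsto (fun n => ‖(a ((p (ns (ms n))).1 x) - a (q.1 x)) • q.2 x‖ ^ 2) atTop
          (𝓝 (‖(a (q.1 x) - a (q.1 x)) • q.2 x‖ ^ 2)) :=
        (((((ha.tendsto _).comp hx2).sub_const _).smul_const _).norm).pow 2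
      simp only [sub_self, zero_smul, norm_zero, ne_eq, OfNat.ofNat_ne_zero, not_false_eq_true,
        zero_pow] at h3
      refine h3.congr fun n => ?_
      rw [hx1 n]
  have hsecond' : Tendsto (fun n => ‖Q (p (ns (ms n))).1 q.2 - Q q.1 q.2‖) atTop (𝓝 0) := by
    have := hsecond.sqrt
    simpa [Real.sqrt_sq (norm_nonneg _)] using this
  rw [tendsto_iff_norm_sub_tendsto_zero]
  refine squeeze_zero (fun n => norm_nonneg _) (fun n => ?_)
    (by simpa using hfirst.add hsecond')
  have hlip : ‖Q (p (ns (ms n))).1 (p (ns (ms n))).2 - Q (p (ns (ms n))).1 q.2‖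
      ≤ M * ‖(p (ns (ms n))).2 - q.2‖ := by
    refine Lp.norm_le_mul_norm_of_ae_le_mul ?_
    filter_upwards [Lp.coeFn_sub (Q (p (ns (ms n))).1 (p (ns (ms n))).2) (Q (p (ns (ms n))).1 q.2),
      hQ (p (ns (ms n))).1 q.2, hQ (p (ns (ms n))).1 (p (ns (ms n))).2,
      Lp.coeFn_sub (p (ns (ms n))).2 q.2] with x h1 h2 h3 h4
    rw [h1, Pi.sub_apply, h2, h3, h4, Pi.sub_apply, ← smul_sub, norm_smul]
    exact mul_le_mul_of_nonneg_right (hM _) (norm_nonneg _)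
  calc _ = ‖(Q (p (ns (ms n))).1 (p (ns (ms n))).2 - Q (p (ns (ms n))).1 q.2)
        + (Q (p (ns (ms n))).1 q.2 - Q q.1 q.2)‖ := by
          rw [sub_add_sub_cancel]; rfl
    _ ≤ _ := (norm_add_le _ _).trans (add_le_add hlip le_rfl)

/-- The gradient of `Φ(φ, ψ)`. -/
theorem gradient_comp_prodMk {Φ : ℝ × ℝ → ℝ} (hΦ : Differentiable ℝ Φ)
    {φ ψ : EuclideanSpace ℝ (Fin N) → ℝ} (hφ : Differentiable ℝ φ) (hψ : Differentiable ℝ ψ)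
    (x : EuclideanSpace ℝ (Fin N)) :
    ∇ (fun x => Φ (φ x, ψ x)) x
      = fderiv ℝ Φ (φ x, ψ x) (1, 0) • ∇ φ x + fderiv ℝ Φ (φ x, ψ x) (0, 1) • ∇ ψ x := by
  have h : HasFDerivAt (fun x => Φ (φ x, ψ x))
      ((fderiv ℝ Φ (φ x, ψ x)).comp ((fderiv ℝ φ x).prod (fderiv ℝ ψ x))) x :=
    HasFDerivAt.comp (g := Φ) x (hΦ _).hasFDerivAt
      ((hφ x).hasFDerivAt.prodMk (hψ x).hasFDerivAt)
  rw [gradient, gradient, gradient, h.fderiv, ← map_smul, ← map_smul, ← map_add]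
  congr 1
  ext y
  have : ((fderiv ℝ φ x y, fderiv ℝ ψ x y) : ℝ × ℝ)
      = fderiv ℝ φ x y • (1, 0) + fderiv ℝ ψ x y • (0, 1) := by simp
  simp only [ContinuousLinearMap.comp_apply, ContinuousLinearMap.prod_apply,
    add_apply, smul_apply]
  rw [this, map_add, map_smul, map_smul]
  simp only [smul_eq_mul]
  ring

/-- Composition of two elements of `H¹₀(Ω)` with a smooth compactly supported function vanishing at
the origin. -/
theorem exists_h10_comp {Φ : ℝ × ℝ → ℝ} (hΦ : ContDiff ℝ ∞ Φ) (hΦc : HasCompactSupport Φ)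
    (hΦ0 : Φ 0 = 0) :
    ∃ P : H10 Ω → H10 Ω → H10 Ω, Continuous (Function.uncurry P) ∧
      ∀ v w, ∀ᵐ x ∂volume.restrict Ω, h10Val (P v w) x = Φ (h10Val v x, h10Val w x) ∧
        h10Grad (P v w) x = fderiv ℝ Φ (h10Val v x, h10Val w x) (1, 0) • h10Grad v x
          + fderiv ℝ Φ (h10Val v x, h10Val w x) (0, 1) • h10Grad w x := by
  obtain ⟨K, hK⟩ := hΦ.lipschitzWith_of_hasCompactSupport hΦc (by simp)
  have hfd : Continuous (fderiv ℝ Φ) := hΦ.continuous_fderiv (by simp)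
  have hA : ∀ e : ℝ × ℝ, Continuous fun y => fderiv ℝ Φ y e := fun e => hfd.clm_apply continuous_const
  have hAb : ∀ e : ℝ × ℝ, ∃ M, ∀ y, |fderiv ℝ Φ y e| ≤ M := by
    intro e
    have hc : HasCompactSupport fun y => fderiv ℝ Φ y e := hΦc.fderiv_apply ℝ e
    obtain ⟨M, hM⟩ := (hA e).bounded_above_of_compact_support hc
    exact ⟨M, hM⟩
  obtain ⟨M₁, hM₁⟩ := hAb (1, 0)
  obtain ⟨M₂, hM₂⟩ := hAb (0, 1)
  obtain ⟨Q₁, hQ₁c, hQ₁⟩ := exists_continuous_smul_Lp (Ω := Ω) (hA (1, 0)) hM₁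
  obtain ⟨Q₂, hQ₂c, hQ₂⟩ := exists_continuous_smul_Lp (Ω := Ω) (hA (0, 1)) hM₂
  let pr : L2Pair Ω → L2Pair Ω → Lp (ℝ × ℝ) 2 (volume.restrict Ω) := fun p q =>
    (ContinuousLinearMap.inl ℝ ℝ ℝ).compLpL 2 (volume.restrict Ω) p.fst
      + (ContinuousLinearMap.inr ℝ ℝ ℝ).compLpL 2 (volume.restrict Ω) q.fst
  have hprc : Continuous (Function.uncurry pr) :=
    (((ContinuousLinearMap.inl ℝ ℝ ℝ).compLpL 2 (volume.restrict Ω)).continuous.comp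
      (L2Pair.continuous_fst.comp continuous_fst)).add
    (((ContinuousLinearMap.inr ℝ ℝ ℝ).compLpL 2 (volume.restrict Ω)).continuous.comp
      (L2Pair.continuous_fst.comp continuous_snd))
  have hpr : ∀ p q : L2Pair Ω, ∀ᵐ x ∂volume.restrict Ω, pr p q x = (p.fst x, q.fst x) := by
    intro p q
    filter_upwards [Lp.coeFn_add ((ContinuousLinearMap.inl ℝ ℝ ℝ).compLpL 2 (volume.restrict Ω) p.fst)
      ((ContinuousLinearMap.inr ℝ ℝ ℝ).compLpL 2 (volume.restrict Ω) q.fst),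
      (ContinuousLinearMap.inl ℝ ℝ ℝ).coeFn_compLpL p.fst,
      (ContinuousLinearMap.inr ℝ ℝ ℝ).coeFn_compLpL q.fst] with x h1 h2 h3
    rw [h1, Pi.add_apply, h2, h3]
    simp
  -- The chain rule formula makes sense for arbitrary pairs, since $\Phi$ is Lipschitz with bounded
  -- derivatives. It is continuous and sends test pairs to test pairs, hence preserves the closure
  -- $H^1_0$.
  let P₀ : L2Pair Ω → L2Pair Ω → L2Pair Ω := fun p q =>
    WithLp.toLp 2 (hK.compLp hΦ0 (pr p q), Q₁ (pr p q) p.snd + Q₂ (pr p q) q.snd)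
  have hP₀c : Continuous (Function.uncurry P₀) := by
    refine (WithLp.prod_continuous_toLp 2 _ _).comp
      (((hK.continuous_compLp hΦ0).comp hprc).prodMk (Continuous.add ?_ ?_))
    · exact hQ₁c.comp (hprc.prodMk (L2Pair.continuous_snd.comp continuous_fst))
    · exact hQ₂c.comp (hprc.prodMk (L2Pair.continuous_snd.comp continuous_snd))
  have hP₀ : ∀ p q : L2Pair Ω, ∀ᵐ x ∂volume.restrict Ω,
      (P₀ p q).fst x = Φ (p.fst x, q.fst x) ∧
      (P₀ p q).snd x = fderiv ℝ Φ (p.fst x, q.fst x) (1, 0) • p.snd x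
        + fderiv ℝ Φ (p.fst x, q.fst x) (0, 1) • q.snd x := by
    intro p q
    filter_upwards [hpr p q, hK.coeFn_compLp hΦ0 (pr p q), hQ₁ (pr p q) p.snd,
      hQ₂ (pr p q) q.snd, Lp.coeFn_add (Q₁ (pr p q) p.snd) (Q₂ (pr p q) q.snd)]
      with x h1 h2 h3 h4 h5
    constructor
    · change (hK.compLp hΦ0 (pr p q)) x = _
      rw [h2, Function.comp, h1]
    · change (Q₁ (pr p q) p.snd + Q₂ (pr p q) q.snd) x = _
      rw [h5, Pi.add_apply, h3, h4, h1]
  have hmem : ∀ p ∈ H10 Ω, ∀ q ∈ H10 Ω, P₀ p q ∈ H10 Ω := by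
    intro p hp q hq
    refine map_mem_closure₂ hP₀c hp hq ?_
    rintro p ⟨φ, h1, h2, h3, h4, h5⟩ q ⟨ψ, k1, k2, k3, k4, k5⟩
    have hsupp : Function.support (fun x => Φ (φ x, ψ x)) ⊆ tsupport φ ∪ tsupport ψ := by
      intro x hx
      by_contra hcon
      rw [mem_union, not_or] at hcon
      refine hx ?_
      simp only [image_eq_zero_of_notMem_tsupport hcon.1, image_eq_zero_of_notMem_tsupport hcon.2]
      exact hΦ0
    have hts : tsupport (fun x => Φ (φ x, ψ x)) ⊆ tsupport φ ∪ tsupport ψ :=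
      closure_minimal hsupp ((isClosed_tsupport _).union (isClosed_tsupport _))
    refine ⟨fun x => Φ (φ x, ψ x), hΦ.comp (h1.prodMk k1),
      HasCompactSupport.of_support_subset_isCompact (h2.isCompact.union k2.isCompact) hsupp,
      hts.trans (union_subset h3 k3), ?_, ?_⟩
    · filter_upwards [hP₀ p q, h4, k4] with x e1 e2 e3
      rw [e1.1, e2, e3]
    · filter_upwards [hP₀ p q, h4, k4, h5, k5] with x e1 e2 e3 e4 e5
      rw [e1.2, e2, e3, e4, e5, gradient_comp_prodMk (hΦ.differentiable (by simp))
        (h1.differentiable (by simp)) (k1.differentiable (by simp))]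
  refine ⟨fun v w => ⟨P₀ v.1 w.1, hmem _ v.2 _ w.2⟩, ?_, fun v w => hP₀ v.1 w.1⟩
  exact (hP₀c.comp ((continuous_subtype_val.comp continuous_fst).prodMk
    (continuous_subtype_val.comp continuous_snd))).subtype_mk _

/-- The weak gradient of an element of `H¹₀(Ω)` is determined by its values. -/
theorem h10_snd_eq_zero_of_fst_eq_zero (hΩ : IsOpen Ω) (hΩb : Bornology.IsBounded Ω) {p : L2Pair Ω}
    (hp : p ∈ H10 Ω) (h0 : p.fst = 0) : p.snd = 0 := by
  have : IsFiniteMeasure (volume.restrict Ω) := ⟨by simpa using hΩb.measure_lt_top⟩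
  have hcoord : ∀ i : Fin N, ∀ᵐ x ∂volume, x ∈ Ω →
      inner ℝ (EuclideanSpace.single i (1 : ℝ)) (p.snd x) = 0 := by
    intro i
    set e : EuclideanSpace ℝ (Fin N) := EuclideanSpace.single i 1 with he
    refine hΩ.ae_eq_zero_of_integral_contDiff_smul_eq_zero ?_ ?_
    · refine IntegrableOn.locallyIntegrableOn ?_
      exact (((Lp.memLp p.snd).integrable (by norm_num)).const_inner e)
    · intro φ hφ hφc hφs
      have hdφ : Continuous fun x => fderiv ℝ φ x e :=
        (hφ.continuous_fderiv (by simp)).clm_apply continuous_const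
      have hdφc : HasCompactSupport fun x => fderiv ℝ φ x e := hφc.fderiv_apply ℝ e
      have hm1 : MemLp (fun x => fderiv ℝ φ x e) 2 (volume.restrict Ω) :=
        hdφ.memLp_of_hasCompactSupport hdφc
      have hm2 : MemLp (fun x => φ x • e) 2 (volume.restrict Ω) :=
        (hφ.continuous.smul continuous_const).memLp_of_hasCompactSupport
          (hφc.smul_right (f' := fun _ => e))
      -- Integration by parts against a fixed $\varphi$ is a closed condition on pairs and holds for
      -- test pairs, so it holds on $H^1_0$. With vanishing first component it leaves
      -- $\int_\Omega\varphi\,e\cdot U=0$ for the second component $U$.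
      have hclosed : IsClosed {q : L2Pair Ω |
          inner ℝ (hm1.toLp _) q.fst + inner ℝ (hm2.toLp _) q.snd = 0} :=
        isClosed_eq ((continuous_const.inner L2Pair.continuous_fst).add
          (continuous_const.inner L2Pair.continuous_snd)) continuous_const
      have hin : ∀ q : L2Pair Ω, inner ℝ (hm1.toLp _) q.fst + inner ℝ (hm2.toLp _) q.snd
          = (∫ x in Ω, q.fst x * fderiv ℝ φ x e) + ∫ x in Ω, φ x * inner ℝ e (q.snd x) := by
        intro q
        rw [L2.inner_def, L2.inner_def]
        congr 1
        · refine integral_congr_ae ?_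
          filter_upwards [hm1.coeFn_toLp] with x hx
          rw [hx]
          simp
        · refine integral_congr_ae ?_
          filter_upwards [hm2.coeFn_toLp] with x hx
          rw [hx, inner_smul_left]
          simp
      have hsub : (testPairs Ω : Set (L2Pair Ω)) ⊆ {q : L2Pair Ω |
          inner ℝ (hm1.toLp _) q.fst + inner ℝ (hm2.toLp _) q.snd = 0} := by
        rintro q ⟨ψ, k1, k2, k3, k4, k5⟩
        rw [mem_ofPred_eq, hin]
        have hdψ : Continuous fun x => fderiv ℝ ψ x e :=
          (k1.continuous_fderiv (by simp)).clm_apply continuous_const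
        have hψ0 : ∀ x, x ∉ Ω → ψ x = 0 := fun x hx =>
          image_eq_zero_of_notMem_tsupport fun h => hx (k3 h)
        have hφ0 : ∀ x, x ∉ Ω → φ x = 0 := fun x hx =>
          image_eq_zero_of_notMem_tsupport fun h => hx (hφs h)
        have e1 : ∫ x in Ω, q.fst x * fderiv ℝ φ x e = ∫ x, ψ x * fderiv ℝ φ x e := by
          refine Eq.trans (integral_congr_ae ?_) (setIntegral_eq_integral_of_forall_compl_eq_zero
            (fun x hx => by rw [hψ0 x hx, zero_mul]))
          filter_upwards [k4] with x hx
          rw [hx]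
        have e2 : ∫ x in Ω, φ x * inner ℝ e (q.snd x) = ∫ x, fderiv ℝ ψ x e * φ x := by
          refine Eq.trans (integral_congr_ae ?_) (setIntegral_eq_integral_of_forall_compl_eq_zero
            (fun x hx => by rw [hφ0 x hx, mul_zero]))
          filter_upwards [k5] with x hx
          rw [hx, real_inner_comm, gradient, InnerProductSpace.toDual_symm_apply, mul_comm]
        rw [e1, e2, integral_mul_fderiv_eq_neg_fderiv_mul_of_integrable, neg_add_cancel]
        · exact (hdψ.mul hφ.continuous).integrable_of_hasCompactSupport hφc.mul_left
        · exact (k1.continuous.mul hdφ).integrable_of_hasCompactSupport k2.mul_right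
        · exact (k1.continuous.mul hφ.continuous).integrable_of_hasCompactSupport k2.mul_right
        · exact fun x _ => k1.differentiable (by simp) x
        · exact fun x _ => hφ.differentiable (by simp) x
      have hpz : inner ℝ (hm1.toLp _) p.fst + inner ℝ (hm2.toLp _) p.snd = 0 :=
        closure_minimal hsub hclosed hp
      have hpz2 : inner ℝ (hm2.toLp _) p.snd = 0 := by
        rwa [h0, inner_zero_right, zero_add] at hpz
      rw [L2.inner_def] at hpz2
      rw [← setIntegral_eq_integral_of_forall_compl_eq_zero (s := Ω) (fun x hx => by
        rw [image_eq_zero_of_notMem_tsupport fun h => hx (hφs h), zero_smul]), ← hpz2]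
      refine integral_congr_ae ?_
      filter_upwards [hm2.coeFn_toLp] with x hx
      rw [hx, inner_smul_left]
      simp
  rw [Lp.ext_iff]
  refine EventuallyEq.trans ?_ (Lp.coeFn_zero _ _ _).symm
  have hall := ae_all_iff.2 hcoord
  rw [EventuallyEq, ae_restrict_iff' hΩ.measurableSet]
  filter_upwards [hall] with x hx hxΩ
  ext i
  simpa [EuclideanSpace.inner_single_left] using hx i hxΩ

/-- Elements of `H10` are pairs, so a field is recognised as a given $w$ from its values alone only
because the weak gradient is unique. -/
theorem h10_ext (hΩ : IsOpen Ω) (hΩb : Bornology.IsBounded Ω) {v w : H10 Ω}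
    (h : h10Val v =ᵐ[volume.restrict Ω] h10Val w) : v = w := by
  have h1 : v.1.fst = w.1.fst := Lp.ext h
  have h2 : (v - w).1.snd = 0 := by
    refine h10_snd_eq_zero_of_fst_eq_zero hΩ hΩb (v - w).2 ?_
    change v.1.fst - w.1.fst = 0
    rw [h1, sub_self]
  have h3 : v.1.snd = w.1.snd := sub_eq_zero.1 h2
  refine Subtype.ext (WithLp.ofLp_injective 2 (Prod.ext h1 h3))

end Composition

/-! ### Testing with $u$ and with bounded directions. -/

section EulerLagrange

variable {N : ℕ} {Ω : Set (EuclideanSpace ℝ (Fin N))}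
  {j : EuclideanSpace ℝ (Fin N) → ℝ → EuclideanSpace ℝ (Fin N) → ℝ}

/-- A smooth compactly supported function `Φ(s, r)` equal to `r` near the origin. -/
theorem exists_cutoff {k : ℝ} (hk : 0 ≤ k) :
    ∃ Φ : ℝ × ℝ → ℝ, ContDiff ℝ ∞ Φ ∧ HasCompactSupport Φ ∧ (∀ s, Φ (s, 0) = 0) ∧
      (∀ s r, |s| ≤ k → |r| ≤ k → Φ (s, r) = r) ∧
      ∀ s r, k + 2 < |s| → Φ (s, r) = 0 ∧ fderiv ℝ Φ (s, r) = 0 := by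
  -- The inner radius $k+1$ is positive even for $k=0$. Beyond $k+2$ the strict inequality describes
  -- an open set, so the derivative vanishes there along with the function.
  let θ : ContDiffBump (0 : ℝ) := ⟨k + 1, k + 2, by linarith, by linarith⟩
  have h1 : ∀ s : ℝ, |s| ≤ k → θ s = 1 := fun s hs => θ.one_of_mem_closedBall (by
    rw [mem_closedBall_zero_iff, Real.norm_eq_abs]
    change |s| ≤ k + 1
    linarith)
  have h0 : ∀ s : ℝ, k + 2 ≤ |s| → θ s = 0 := fun s hs => θ.zero_of_le_dist (by
    rw [dist_zero_right, Real.norm_eq_abs]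
    exact hs)
  have hz : ∀ s r : ℝ, k + 2 < |s| → θ s * (r * θ r) = 0 := fun s r hs => by
    rw [h0 s hs.le, zero_mul]
  refine ⟨fun p => θ p.1 * (p.2 * θ p.2), ?_, ?_, fun s => by simp, fun s r hs hr => ?_,
    fun s r hs => ⟨hz s r hs, ?_⟩⟩
  · exact (θ.contDiff.comp contDiff_fst).mul (contDiff_snd.mul (θ.contDiff.comp contDiff_snd))
  · refine HasCompactSupport.of_support_subset_isCompact
      ((isCompact_closedBall (0 : ℝ) (k + 2)).prod (isCompact_closedBall (0 : ℝ) (k + 2))) ?_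
    intro p hp
    simp only [mem_prod, mem_closedBall_zero_iff, Real.norm_eq_abs]
    constructor
    · by_contra! h
      exact hp (hz _ _ h)
    · by_contra! h
      refine hp ?_
      simp only [h0 p.2 h.le, mul_zero]
  · simp only [h1 s hs, h1 r hr, mul_one, one_mul]
  · have hopen : IsOpen {p : ℝ × ℝ | k + 2 < |p.1|} :=
      isOpen_lt continuous_const continuous_fst.abs
    have hev : (fun p : ℝ × ℝ => θ p.1 * (p.2 * θ p.2)) =ᶠ[𝓝 (s, r)] fun _ => 0 := by
      filter_upwards [hopen.mem_nhds hs] with p hp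
      exact hz _ _ hp
    rw [hev.fderiv_eq, fderiv_fun_const]
    rfl

theorem MeasureTheory.MemLp.exists_ae_abs_le {X : Type*} [MeasurableSpace X] {ν : Measure X}
    {f : X → ℝ} (hf : MemLp f ⊤ ν) : ∃ k : ℝ, ∀ᵐ x ∂ν, |f x| ≤ k := by
  refine ⟨(eLpNormEssSup f ν).toReal, ?_⟩
  have hfin : eLpNormEssSup f ν < ⊤ := by
    rw [← eLpNorm_exponent_top]
    exact hf.2
  filter_upwards [ae_le_eLpNormEssSup (f := f) (μ := ν)] with x hx
  have := ENNReal.toReal_mono hfin.ne hx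
  simpa using this

/-- The bounded elements of `H¹₀(Ω)` on whose support `u` is bounded. -/
def boundedTest (Ω : Set (EuclideanSpace ℝ (Fin N))) (u : EuclideanSpace ℝ (Fin N) → ℝ) :
    Submodule ℝ (H10 Ω) where
  carrier := {w | ∃ k : ℝ, ∀ᵐ x ∂volume.restrict Ω,
    |h10Val w x| ≤ k ∧ (h10Val w x ≠ 0 → |u x| ≤ k)}
  zero_mem' := by
    refine ⟨0, ?_⟩
    filter_upwards [Lp.coeFn_zero ℝ 2 (volume.restrict Ω)] with x hx
    have : h10Val (0 : H10 Ω) x = 0 := hx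
    simp [this]
  add_mem' := by
    rintro v w ⟨k, hk⟩ ⟨l, hl⟩
    refine ⟨|k| + |l|, ?_⟩
    filter_upwards [hk, hl, Lp.coeFn_add v.1.fst w.1.fst] with x h1 h2 h3
    have h3 : h10Val (v + w) x = h10Val v x + h10Val w x := h3
    have hk := le_abs_self k
    have hl := le_abs_self l
    have hk0 := abs_nonneg k
    have hl0 := abs_nonneg l
    rw [h3]
    refine ⟨(abs_add_le _ _).trans (by linarith [h1.1, h2.1]), fun hne => ?_⟩
    by_cases hv : h10Val v x = 0
    · have := h2.2 (fun hw => hne (by rw [hv, hw, add_zero]))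
      linarith
    · have := h1.2 hv
      linarith
  smul_mem' := by
    rintro c w ⟨k, hk⟩
    refine ⟨|c| * |k| + |k|, ?_⟩
    filter_upwards [hk, Lp.coeFn_smul c w.1.fst] with x h1 h2
    have h2 : h10Val (c • w) x = c * h10Val w x := h2
    have hk := le_abs_self k
    rw [h2]
    refine ⟨?_, fun hne => ?_⟩
    · rw [abs_mul]
      have := mul_le_mul_of_nonneg_left (h1.1.trans hk) (abs_nonneg c)
      linarith [abs_nonneg k]
    · have := h1.2 (fun hw => hne (by rw [hw, mul_zero]))
      have : 0 ≤ |c| * |k| := by positivity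
      linarith

/-- Passing to `boundedTest` gives one constant for both bounds and the submodule on which
Hahn–Banach is applied. -/
theorem VSpace_subset_boundedTest {u : EuclideanSpace ℝ (Fin N) → ℝ} {w : H10 Ω}
    (hw : w ∈ VSpace Ω u) : w ∈ boundedTest Ω u := by
  obtain ⟨k, hk⟩ := hw.1.exists_ae_abs_le
  obtain ⟨l, hl⟩ := hw.2.exists_ae_abs_le
  refine ⟨max k l, ?_⟩
  filter_upwards [hk, ae_imp_of_ae_restrict hl] with x h1 h2
  exact ⟨h1.trans (le_max_left _ _), fun h => (h2 h).trans (le_max_right _ _)⟩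

/-- Every bounded test direction extends to a continuous field on `H¹₀(Ω)` whose value at `v` is
bounded and vanishes where `|v|` is large. -/
theorem exists_truncated_field (hΩ : IsOpen Ω) (hΩb : Bornology.IsBounded Ω) {u w : H10 Ω}
    (hw : w ∈ boundedTest Ω (h10Val u)) :
    ∃ (Z : H10 Ω → H10 Ω) (K L : ℝ), Continuous Z ∧ Z u = w ∧ 0 ≤ L ∧
      ∀ v, ∀ᵐ x ∂volume.restrict Ω, |h10Val (Z v) x| ≤ L ∧
        (K < |h10Val v x| → h10Val (Z v) x = 0 ∧ h10Grad (Z v) x = 0) := by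
  obtain ⟨k₀, hk₀⟩ := hw
  obtain ⟨Φ, hΦ, hΦc, hΦ0, hΦid, hΦout⟩ := exists_cutoff (abs_nonneg k₀)
  obtain ⟨P, hPc, hP⟩ := exists_h10_comp (Ω := Ω) hΦ hΦc (hΦ0 0)
  obtain ⟨B, hB⟩ := hΦ.continuous.bounded_above_of_compact_support hΦc
  refine ⟨fun v => P v w, |k₀| + 2, B, hPc.comp (continuous_id.prodMk continuous_const), ?_,
    (norm_nonneg _).trans (hB 0), fun v => ?_⟩
  -- Where $w\ne0$, both $|u|$ and $|w|$ lie in the range where $\Phi(s,r)=r$; where $w=0$,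
  -- $\Phi(s,0)=0$ whatever the size of $u$.
  · refine h10_ext hΩ hΩb ?_
    filter_upwards [hP u w, hk₀] with x h1 h2
    rw [h1.1]
    by_cases h0 : h10Val w x = 0
    · rw [h0, hΦ0]
    · exact hΦid _ _ ((h2.2 h0).trans (le_abs_self _)) (h2.1.trans (le_abs_self _))
  · filter_upwards [hP v w] with x h1
    rw [h1.1, h1.2]
    refine ⟨hB _, fun hv => ?_⟩
    obtain ⟨e1, e2⟩ := hΦout _ (h10Val w x) hv
    rw [e1, e2]
    simp

theorem exists_bound_of_continuousOn_Ici {g : ℝ → ℝ} (hg : ContinuousOn g (Ici 0)) (K : ℝ) :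
    ∃ M, 0 ≤ M ∧ ∀ s : ℝ, |s| ≤ K → g |s| ≤ M := by
  obtain ⟨M, hM⟩ := isCompact_Icc.exists_bound_of_continuousOn
    (hg.mono fun x (hx : x ∈ Icc 0 K) => hx.1)
  exact ⟨|M|, abs_nonneg M, fun s hs => (le_abs_self _).trans
    ((hM _ ⟨abs_nonneg s, hs⟩).trans (le_abs_self M))⟩

theorem exists_local_growth {γ μ : ℝ → ℝ} (hγ : ContinuousOn γ (Ici 0))
    (hμ : ContinuousOn μ (Ici 0))
    (hj_growth' : ∀ᵐ x ∂volume.restrict Ω, ∀ s ξ,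
      |jS j x s ξ| ≤ γ |s| * ‖ξ‖ ^ 2 ∧ ‖jXi j x s ξ‖ ≤ μ |s| * ‖ξ‖) (K : ℝ) :
    ∃ Γ M : ℝ, 0 ≤ Γ ∧ 0 ≤ M ∧ ∀ᵐ x ∂volume.restrict Ω, ∀ s ξ, |s| ≤ K →
      |jS j x s ξ| ≤ Γ * ‖ξ‖ ^ 2 ∧ ‖jXi j x s ξ‖ ≤ M * ‖ξ‖ := by
  obtain ⟨Γ, hΓ0, hΓ⟩ := exists_bound_of_continuousOn_Ici hγ K
  obtain ⟨M, hM0, hM⟩ := exists_bound_of_continuousOn_Ici hμ K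
  refine ⟨Γ, M, hΓ0, hM0, ?_⟩
  filter_upwards [hj_growth'] with x hx s ξ hs
  exact ⟨(hx s ξ).1.trans (mul_le_mul_of_nonneg_right (hΓ s hs) (by positivity)),
    (hx s ξ).2.trans (mul_le_mul_of_nonneg_right (hM s hs) (by positivity))⟩

theorem aemeasurable_inner_jXi
    (hj_meas : ∀ s ξ, AEMeasurable (fun x => j x s ξ) (volume.restrict Ω))
    (hj_C1 : ∀ᵐ x ∂volume.restrict Ω,
      ContDiff ℝ 1 (fun p : ℝ × EuclideanSpace ℝ (Fin N) => j x p.1 p.2)) (u w : H10 Ω) :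
    AEMeasurable (fun x => inner ℝ (jXi j x (h10Val u x) (h10Grad u x)) (h10Grad w x))
      (volume.restrict Ω) := by
  have := aemeasurable_derivative hj_meas hj_C1 (aestronglyMeasurable_h10Val u)
    (aestronglyMeasurable_h10Grad u) (c := fun _ => 0) aestronglyMeasurable_const
    (aestronglyMeasurable_h10Grad w)
  simpa using this

theorem aemeasurable_jS_mul
    (hj_meas : ∀ s ξ, AEMeasurable (fun x => j x s ξ) (volume.restrict Ω))
    (hj_C1 : ∀ᵐ x ∂volume.restrict Ω,
      ContDiff ℝ 1 (fun p : ℝ × EuclideanSpace ℝ (Fin N) => j x p.1 p.2)) (u w : H10 Ω) :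
    AEMeasurable (fun x => jS j x (h10Val u x) (h10Grad u x) * h10Val w x)
      (volume.restrict Ω) := by
  have := aemeasurable_derivative hj_meas hj_C1 (aestronglyMeasurable_h10Val u)
    (aestronglyMeasurable_h10Grad u) (aestronglyMeasurable_h10Val w) (d := fun _ => 0)
    aestronglyMeasurable_const
  simpa using this

/-- The Euler–Lagrange expression tested with `u` itself. -/
theorem derivative_self_le_weakSlope
    (hj_meas : ∀ s ξ, AEMeasurable (fun x => j x s ξ) (volume.restrict Ω))
    (hj_C1 : ∀ᵐ x ∂volume.restrict Ω,
      ContDiff ℝ 1 (fun p : ℝ × EuclideanSpace ℝ (Fin N) => j x p.1 p.2))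
    (hj_convex : ∀ᵐ x ∂volume.restrict Ω, ∀ s, ConvexOn ℝ univ (fun ξ => j x s ξ))
    (hj_nonneg : ∀ᵐ x ∂volume.restrict Ω, ∀ s ξ, 0 ≤ j x s ξ)
    (hj_zero : ∀ᵐ x ∂volume.restrict Ω, ∀ s, j x s 0 = 0)
    {γ μ : ℝ → ℝ} (hγ : ContinuousOn γ (Ici 0)) (hμ : ContinuousOn μ (Ici 0))
    (hj_growth' : ∀ᵐ x ∂volume.restrict Ω, ∀ s ξ,
      |jS j x s ξ| ≤ γ |s| * ‖ξ‖ ^ 2 ∧ ‖jXi j x s ξ‖ ≤ μ |s| * ‖ξ‖)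
    {ε R : ℝ} (hε0 : 0 < ε) (hR : 0 ≤ R)
    (hsign : ∀ᵐ x ∂volume.restrict Ω, ∀ s ξ, R ≤ |s| →
      0 ≤ (1 - ε) * inner ℝ (jXi j x s ξ) ξ + jS j x s ξ * s)
    (u : H10 Ω) (hu : energy Ω j u ≠ ⊤) (hslope : weakSlope (energy Ω j) u hu < ⊤) :
    Integrable (fun x => inner ℝ (jXi j x (h10Val u x) (h10Grad u x)) (h10Grad u x))
        (volume.restrict Ω) ∧
      Integrable (fun x => jS j x (h10Val u x) (h10Grad u x) * h10Val u x) (volume.restrict Ω) ∧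
      ∫ x in Ω, (inner ℝ (jXi j x (h10Val u x) (h10Grad u x)) (h10Grad u x)
          + jS j x (h10Val u x) (h10Grad u x) * h10Val u x)
        ≤ (weakSlope (energy Ω j) u hu).toReal * ‖u‖ := by
  -- For the field $-v$ both the value and the increment are at most $2R$ on the set where the
  -- growth bounds are used, hence the range $2R+2R$.
  obtain ⟨Γ, M, hΓ, hM, hbd⟩ := exists_local_growth hγ hμ hj_growth' (2 * R + 2 * R)
  have hnegv : ∀ v : H10 Ω, ∀ᵐ x ∂volume.restrict Ω, h10Val (-v) x = -h10Val v x := fun v =>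
    Lp.coeFn_neg v.1.fst
  have hnegg : ∀ v : H10 Ω, ∀ᵐ x ∂volume.restrict Ω, h10Grad (-v) x = -h10Grad v x := fun v =>
    Lp.coeFn_neg v.1.snd
  have hC : 0 ≤ 2 * Γ * (2 * R) + 2 * M := by positivity
  obtain ⟨hint, hle⟩ := integral_derivative_le_weakSlope hj_meas hj_C1 hj_nonneg
    (Z := fun v => -v) continuous_neg (t₀ := 1 / 2) hC (by norm_num) (by
      intro v t ht
      filter_upwards [hnegv v, hnegg v, hbd, hj_C1, hj_convex, hj_nonneg, hj_zero, hsign]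
        with x e1 e2 hx hx1 hx2 hx3 hx4 hx5
      rw [e1, e2]
      have ht0 : 0 ≤ t := ht.1.le
      rcases le_total (2 * R) |h10Val v x| with hs | hs
      · refine (integrand_scaling_le hx1 hx2 (fun s ξ => (hx4 s).trans_le (hx3 s ξ)) hε0.le hx5 hs
          ⟨ht0, ht.2⟩ _).trans ?_
        exact le_add_of_nonneg_right (by positivity)
      · have := abs_integrand_sub_le hx1 hΓ hM hx hs (z := -h10Val v x) (by rwa [abs_neg])
          ⟨ht0, ht.2.trans (by norm_num)⟩ (h10Grad v x) (-h10Grad v x)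
        linarith [le_abs_self (j x (h10Val v x + t * -h10Val v x)
          (h10Grad v x + t • -h10Grad v x) - j x (h10Val v x) (h10Grad v x))]) u hu hslope
  have hq : ∀ᵐ x ∂volume.restrict Ω, jS j x (h10Val u x) (h10Grad u x) * h10Val (-u) x
        + inner ℝ (jXi j x (h10Val u x) (h10Grad u x)) (h10Grad (-u) x)
      = -(inner ℝ (jXi j x (h10Val u x) (h10Grad u x)) (h10Grad u x)
          + jS j x (h10Val u x) (h10Grad u x) * h10Val u x) := by
    filter_upwards [hnegv u, hnegg u] with x e1 e2
    rw [e1, e2, inner_neg_right]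
    ring
  have hsum : Integrable (fun x => inner ℝ (jXi j x (h10Val u x) (h10Grad u x)) (h10Grad u x)
      + jS j x (h10Val u x) (h10Grad u x) * h10Val u x) (volume.restrict Ω) := by
    refine (hint.congr hq).neg.congr (.of_forall fun x => ?_)
    simp
  rw [integral_congr_ae hq, integral_neg, norm_neg, neg_le_neg_iff] at hle
  -- Where $|u|\ge R$ the sign condition reads $\varepsilon\,j_\xi\cdot\nabla u\le j_\xi\cdot\nabla
  -- u+j_s u$, whose right side is integrable; where $|u|\le R$ the bound $M|\nabla u|^2$ takes
  -- over.
  have hfirst : Integrable (fun x => inner ℝ (jXi j x (h10Val u x) (h10Grad u x)) (h10Grad u x))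
      (volume.restrict Ω) := by
    refine ((hsum.norm.const_mul ε⁻¹).add ((integrable_sq_norm_Lp u.1.snd).const_mul M)).mono'
      (aemeasurable_inner_jXi hj_meas hj_C1 u u).aestronglyMeasurable ?_
    filter_upwards [hbd, hj_C1, hj_convex, hj_nonneg, hj_zero, hsign] with x hx hx1 hx2 hx3 hx4 hx5
    have hnn : 0 ≤ inner ℝ (jXi j x (h10Val u x) (h10Grad u x)) (h10Grad u x) :=
      inner_jXi_self_nonneg hx1 (hx2 _) (fun ξ => (hx4 _).trans_le (hx3 _ ξ)) _
    rw [Real.norm_of_nonneg hnn]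
    simp only [Pi.add_apply]
    change _ ≤ _ + M * ‖h10Grad u x‖ ^ 2
    rcases le_total R |h10Val u x| with hs | hs
    · have h1 := hx5 _ (h10Grad u x) hs
      refine le_add_of_le_of_nonneg ?_ (by positivity)
      rw [← div_eq_inv_mul, le_div_iff₀ hε0]
      refine le_trans ?_ (Real.le_norm_self _)
      linarith
    · have h1 := (hx (h10Val u x) (h10Grad u x) (by linarith)).2
      refine le_add_of_nonneg_of_le (by positivity) ?_
      refine (real_inner_le_norm _ _).trans ?_
      rw [pow_two, ← mul_assoc]
      exact mul_le_mul_of_nonneg_right h1 (norm_nonneg _)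
  refine ⟨hfirst, ?_, hle⟩
  refine (hsum.sub hfirst).congr (.of_forall fun x => ?_)
  simp

/-- The derivative of the energy at `u` along a bounded test direction is well defined and bounded
below by `-|dI|(u) ‖w‖`. -/
theorem derivative_test_ge_weakSlope (hΩ : IsOpen Ω) (hΩb : Bornology.IsBounded Ω)
    (hj_meas : ∀ s ξ, AEMeasurable (fun x => j x s ξ) (volume.restrict Ω))
    (hj_C1 : ∀ᵐ x ∂volume.restrict Ω,
      ContDiff ℝ 1 (fun p : ℝ × EuclideanSpace ℝ (Fin N) => j x p.1 p.2))
    (hj_nonneg : ∀ᵐ x ∂volume.restrict Ω, ∀ s ξ, 0 ≤ j x s ξ)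
    {γ μ : ℝ → ℝ} (hγ : ContinuousOn γ (Ici 0)) (hμ : ContinuousOn μ (Ici 0))
    (hj_growth' : ∀ᵐ x ∂volume.restrict Ω, ∀ s ξ,
      |jS j x s ξ| ≤ γ |s| * ‖ξ‖ ^ 2 ∧ ‖jXi j x s ξ‖ ≤ μ |s| * ‖ξ‖)
    (u : H10 Ω) (hu : energy Ω j u ≠ ⊤) (hslope : weakSlope (energy Ω j) u hu < ⊤)
    {w : H10 Ω} (hw : w ∈ boundedTest Ω (h10Val u)) :
    Integrable (fun x => inner ℝ (jXi j x (h10Val u x) (h10Grad u x)) (h10Grad w x))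
        (volume.restrict Ω) ∧
      Integrable (fun x => jS j x (h10Val u x) (h10Grad u x) * h10Val w x) (volume.restrict Ω) ∧
      -((weakSlope (energy Ω j) u hu).toReal * ‖w‖) ≤
        (∫ x in Ω, inner ℝ (jXi j x (h10Val u x) (h10Grad u x)) (h10Grad w x))
          + ∫ x in Ω, jS j x (h10Val u x) (h10Grad u x) * h10Val w x := by
  obtain ⟨Z, K, L, hZ, hZu, hL, hZv⟩ := exists_truncated_field hΩ hΩb hw
  obtain ⟨Γ, M, hΓ, hM, hbd⟩ := exists_local_growth hγ hμ hj_growth' (K + L)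
  have hC : 0 ≤ 2 * Γ * L + 2 * M := by positivity
  -- Where $|v|>K$ the field and its gradient vanish, so nothing changes; elsewhere all arguments of
  -- $j$ stay within $K+L$. The integrability of the sum is dropped because each term is shown
  -- integrable separately.
  obtain ⟨-, hle⟩ := integral_derivative_le_weakSlope hj_meas hj_C1 hj_nonneg
    hZ (t₀ := 1) hC one_pos (by
      intro v t ht
      filter_upwards [hZv v, hbd, hj_C1] with x hx hx1 hx2
      have ht0 : 0 ≤ t := ht.1.le
      rcases lt_or_ge K |h10Val v x| with hs | hs
      · obtain ⟨e1, e2⟩ := hx.2 hs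
        rw [e1, e2, mul_zero, add_zero, smul_zero, add_zero]
        exact le_add_of_nonneg_right (by positivity)
      · have := abs_integrand_sub_le hx2 hΓ hM hx1 hs hx.1 ⟨ht0, ht.2⟩ (h10Grad v x)
          (h10Grad (Z v) x)
        linarith [le_abs_self (j x (h10Val v x + t * h10Val (Z v) x)
          (h10Grad v x + t • h10Grad (Z v) x) - j x (h10Val v x) (h10Grad v x))]) u hu hslope
  -- Because $Z(u)=w$, both $w$ and its gradient vanish a.e. where $|u|>K$.
  have hwu := hZv u
  rw [hZu] at hle hwu
  have h1 : Integrable (fun x => inner ℝ (jXi j x (h10Val u x) (h10Grad u x)) (h10Grad w x))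
      (volume.restrict Ω) := by
    refine (integrable_gradient_sq M u w).mono'
      (aemeasurable_inner_jXi hj_meas hj_C1 u w).aestronglyMeasurable ?_
    filter_upwards [hwu, hbd] with x hx hx1
    rcases lt_or_ge K |h10Val u x| with hs | hs
    · rw [(hx.2 hs).2, inner_zero_right, norm_zero]
      positivity
    · refine (norm_inner_le_norm _ _).trans ?_
      calc _ ≤ (M * ‖h10Grad u x‖) * ‖h10Grad w x‖ :=
            mul_le_mul_of_nonneg_right (hx1 _ _ (by linarith)).2 (norm_nonneg _)
        _ = M * (‖h10Grad u x‖ * ‖h10Grad w x‖) := by ring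
        _ ≤ _ := by
          refine mul_le_mul_of_nonneg_left ?_ hM
          nlinarith [sq_nonneg (‖h10Grad u x‖ - ‖h10Grad w x‖), sq_nonneg ‖h10Grad u x‖,
            sq_nonneg ‖h10Grad w x‖]
  have h2 : Integrable (fun x => jS j x (h10Val u x) (h10Grad u x) * h10Val w x)
      (volume.restrict Ω) := by
    refine ((integrable_sq_norm_Lp u.1.snd).const_mul (Γ * L)).mono'
      (aemeasurable_jS_mul hj_meas hj_C1 u w).aestronglyMeasurable ?_
    filter_upwards [hwu, hbd] with x hx hx1
    change _ ≤ Γ * L * ‖h10Grad u x‖ ^ 2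
    rcases lt_or_ge K |h10Val u x| with hs | hs
    · rw [(hx.2 hs).1, mul_zero, norm_zero]
      positivity
    · rw [norm_mul]
      calc _ ≤ (Γ * ‖h10Grad u x‖ ^ 2) * L :=
            mul_le_mul (hx1 _ _ (by linarith)).1 hx.1 (abs_nonneg _) (by positivity)
        _ = _ := by ring
  refine ⟨h1, h2, ?_⟩
  rw [integral_add h2 h1] at hle
  linarith

theorem derivative_test_add_smul {u v w : H10 Ω}
    (v1 : Integrable (fun x => inner ℝ (jXi j x (h10Val u x) (h10Grad u x)) (h10Grad v x))
      (volume.restrict Ω))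
    (v2 : Integrable (fun x => jS j x (h10Val u x) (h10Grad u x) * h10Val v x)
      (volume.restrict Ω))
    (w1 : Integrable (fun x => inner ℝ (jXi j x (h10Val u x) (h10Grad u x)) (h10Grad w x))
      (volume.restrict Ω))
    (w2 : Integrable (fun x => jS j x (h10Val u x) (h10Grad u x) * h10Val w x)
      (volume.restrict Ω)) (t : ℝ) :
    (∫ x in Ω, inner ℝ (jXi j x (h10Val u x) (h10Grad u x)) (h10Grad (v + t • w) x))
        + ∫ x in Ω, jS j x (h10Val u x) (h10Grad u x) * h10Val (v + t • w) x
      = ((∫ x in Ω, inner ℝ (jXi j x (h10Val u x) (h10Grad u x)) (h10Grad v x))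
        + ∫ x in Ω, jS j x (h10Val u x) (h10Grad u x) * h10Val v x)
        + t * ((∫ x in Ω, inner ℝ (jXi j x (h10Val u x) (h10Grad u x)) (h10Grad w x))
          + ∫ x in Ω, jS j x (h10Val u x) (h10Grad u x) * h10Val w x) := by
  have e1 : ∫ x in Ω, inner ℝ (jXi j x (h10Val u x) (h10Grad u x)) (h10Grad (v + t • w) x)
      = (∫ x in Ω, inner ℝ (jXi j x (h10Val u x) (h10Grad u x)) (h10Grad v x))
        + t * ∫ x in Ω, inner ℝ (jXi j x (h10Val u x) (h10Grad u x)) (h10Grad w x) := by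
    rw [← integral_const_mul, ← integral_add v1 (w1.const_mul t)]
    refine integral_congr_ae ?_
    filter_upwards [h10Grad_add_smul v w t] with x hx
    rw [hx, inner_add_right, inner_smul_right]
  have e2 : ∫ x in Ω, jS j x (h10Val u x) (h10Grad u x) * h10Val (v + t • w) x
      = (∫ x in Ω, jS j x (h10Val u x) (h10Grad u x) * h10Val v x)
        + t * ∫ x in Ω, jS j x (h10Val u x) (h10Grad u x) * h10Val w x := by
    rw [← integral_const_mul, ← integral_add v2 (w2.const_mul t)]
    refine integral_congr_ae ?_
    filter_upwards [h10Val_add_smul v w t] with x hx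
    rw [hx]
    ring
  rw [e1, e2]
  ring

end EulerLagrange

/-! ### Representation by a functional and conclusion. -/

/-- A lower bound suffices: applied to $-w$ it gives the upper one, and the norm-preserving
Hahn–Banach extension applies. -/
theorem exists_dual_extension {E : Type*} [NormedAddCommGroup E] [NormedSpace ℝ E]
    (p : Submodule ℝ E) (L : E → ℝ) {c : ℝ} (hc : 0 ≤ c)
    (hlin : ∀ v ∈ p, ∀ w ∈ p, ∀ t : ℝ, L (v + t • w) = L v + t * L w)
    (hbound : ∀ w ∈ p, -(c * ‖w‖) ≤ L w) :
    ∃ Ψ : StrongDual ℝ E, ‖Ψ‖ ≤ c ∧ ∀ w ∈ p, L w = Ψ w := by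
  have h0 : L 0 = 0 := by
    have := hlin 0 p.zero_mem 0 p.zero_mem 1
    simp only [smul_zero, add_zero, one_mul] at this
    linarith
  have hneg : ∀ w ∈ p, L (-w) = -L w := by
    intro w hw
    have := hlin 0 p.zero_mem w hw (-1)
    simpa [h0] using this
  let f : p →ₗ[ℝ] ℝ :=
    { toFun := fun w => L w
      map_add' := fun v w => by simpa using hlin v v.2 w w.2 1
      map_smul' := fun t w => by simpa [h0] using hlin 0 p.zero_mem w w.2 t }
  have hf : ∀ w : p, ‖f w‖ ≤ c * ‖w‖ := by
    intro w
    have h1 := hbound w w.2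
    have h2 := hbound (-w) (p.neg_mem w.2)
    rw [hneg _ w.2, norm_neg] at h2
    rw [Real.norm_eq_abs]
    exact abs_le.2 ⟨h1, by change L w ≤ c * ‖(w : E)‖; linarith⟩
  obtain ⟨Ψ, hΨ, hn⟩ := exists_extension_norm_eq p (f.mkContinuous c hf)
  refine ⟨Ψ, hn.trans_le (f.mkContinuous_norm_le hc hf), fun w hw => ?_⟩
  exact (hΨ ⟨w, hw⟩).symm

theorem proposition2p11 {N : ℕ} (Ω : Set (EuclideanSpace ℝ (Fin N)))
    (hΩ : IsOpen Ω) (hΩb : Bornology.IsBounded Ω)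
    (j : EuclideanSpace ℝ (Fin N) → ℝ → EuclideanSpace ℝ (Fin N) → ℝ)
    (hj_meas : ∀ s ξ, AEMeasurable (fun x => j x s ξ) (volume.restrict Ω))
    (hj_C1 : ∀ᵐ x ∂volume.restrict Ω,
      ContDiff ℝ 1 (fun p : ℝ × EuclideanSpace ℝ (Fin N) => j x p.1 p.2))
    (hj_convex : ∀ᵐ x ∂volume.restrict Ω, ∀ s, StrictConvexOn ℝ univ (fun ξ => j x s ξ))
    (α γ μ : ℝ → ℝ)
    (hα : ContinuousOn α (Ici 0)) (hγ : ContinuousOn γ (Ici 0)) (hμ : ContinuousOn μ (Ici 0))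
    (hα1 : ∀ r, 0 ≤ r → 1 ≤ α r) (hγ0 : ∀ r, 0 ≤ r → 0 ≤ γ r) (hμ0 : ∀ r, 0 ≤ r → 0 ≤ μ r)
    (hj_growth : ∀ᵐ x ∂volume.restrict Ω, ∀ s ξ,
      1 / α |s| * ‖ξ‖ ^ 2 ≤ j x s ξ ∧ j x s ξ ≤ α |s| * ‖ξ‖ ^ 2)
    (hj_growth' : ∀ᵐ x ∂volume.restrict Ω, ∀ s ξ,
      |jS j x s ξ| ≤ γ |s| * ‖ξ‖ ^ 2 ∧ ‖jXi j x s ξ‖ ≤ μ |s| * ‖ξ‖)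
    (ε R : ℝ) (hε0 : 0 < ε) (hε1 : ε < 1) (hR : 0 ≤ R)
    (hsign : ∀ᵐ x ∂volume.restrict Ω, ∀ s ξ, R ≤ |s| →
      0 ≤ (1 - ε) * inner ℝ (jXi j x s ξ) ξ + jS j x s ξ * s)
    (u : H10 Ω) (hu : energy Ω j u ≠ ⊤)
    (hslope : weakSlope (energy Ω j) u hu < ⊤) :
    (Integrable (fun x => inner ℝ (jXi j x (h10Val u x) (h10Grad u x)) (h10Grad u x))
        (volume.restrict Ω) ∧
      Integrable (fun x => jS j x (h10Val u x) (h10Grad u x) * h10Val u x) (volume.restrict Ω) ∧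
      ∫ x in Ω, (inner ℝ (jXi j x (h10Val u x) (h10Grad u x)) (h10Grad u x)
          + jS j x (h10Val u x) (h10Grad u x) * h10Val u x)
        ≤ (weakSlope (energy Ω j) u hu).toReal * ‖u‖) ∧
    ∃ Ψ : StrongDual ℝ (H10 Ω), ‖Ψ‖ ≤ (weakSlope (energy Ω j) u hu).toReal ∧
      ∀ w ∈ VSpace Ω (h10Val u),
        Integrable (fun x => inner ℝ (jXi j x (h10Val u x) (h10Grad u x)) (h10Grad w x))
          (volume.restrict Ω) ∧
        Integrable (fun x => jS j x (h10Val u x) (h10Grad u x) * h10Val w x) (volume.restrict Ω) ∧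
        (∫ x in Ω, inner ℝ (jXi j x (h10Val u x) (h10Grad u x)) (h10Grad w x))
          + ∫ x in Ω, jS j x (h10Val u x) (h10Grad u x) * h10Val w x = Ψ w := by
  have hj_nonneg : ∀ᵐ x ∂volume.restrict Ω, ∀ s ξ, 0 ≤ j x s ξ := by
    filter_upwards [hj_growth] with x hx s ξ
    have := hα1 |s| (abs_nonneg s)
    exact le_trans (by positivity) (hx s ξ).1
  -- With nonnegativity, this makes the origin a minimum of $j(x,s,\cdot)$, which gives
  -- $j_\xi\cdot\xi\ge0$ by convexity.
  have hj_zero : ∀ᵐ x ∂volume.restrict Ω, ∀ s, j x s 0 = 0 := by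
    filter_upwards [hj_growth] with x hx s
    have := hx s 0
    simp only [norm_zero, ne_eq, OfNat.ofNat_ne_zero, not_false_eq_true, zero_pow, mul_zero] at this
    exact le_antisymm this.2 this.1
  refine ⟨derivative_self_le_weakSlope hj_meas hj_C1
    (hj_convex.mono fun x h s => (h s).convexOn) hj_nonneg hj_zero hγ hμ hj_growth' hε0 hR hsign
    u hu hslope, ?_⟩
  have htest := fun w (hw : w ∈ boundedTest Ω (h10Val u)) =>
    derivative_test_ge_weakSlope hΩ hΩb hj_meas hj_C1 hj_nonneg hγ hμ hj_growth' u hu hslope hw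
  obtain ⟨Ψ, hΨ, hΨw⟩ := exists_dual_extension (boundedTest Ω (h10Val u))
    (fun w => (∫ x in Ω, inner ℝ (jXi j x (h10Val u x) (h10Grad u x)) (h10Grad w x))
      + ∫ x in Ω, jS j x (h10Val u x) (h10Grad u x) * h10Val w x)
    (c := (weakSlope (energy Ω j) u hu).toReal) ENNReal.toReal_nonneg
    (fun v hv w hw t => derivative_test_add_smul (htest v hv).1 (htest v hv).2.1 (htest w hw).1
      (htest w hw).2.1 t) (fun w hw => (htest w hw).2.2)
  refine ⟨Ψ, hΨ, fun w hw => ?_⟩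
  have hw' := VSpace_subset_boundedTest hw
  exact ⟨(htest w hw').1, (htest w hw').2.1, hΨw w hw'⟩
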